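/- Write $\tilde I=\begin{bmatrix}0&-1\\1&0\end{bmatrix}$, $\tilde J=\begin{bmatrix}1&0\\0&-1\end{bmatrix}$, $\tilde K=\begin{bmatrix}0&1\\1&0\end{bmatrix}$, and let $\tilde{\mathbb K}=\{-\sin\beta\,\tilde J+\cos\beta\,\tilde K:\beta\in[0,2\pi)\}$ be the set of conjugates of $\tilde K$ by orthogonal matrices. Let $D(0,r)$ and $\bar D(0,r)$ be the open and closed disks of radius $r$ around $0$ in $\mathbb C$. For $A=\begin{bmatrix}a&b\\c&d\end{bmatrix}\in M_2(\mathbb R)$ let the chiral disk $CD(A)\subset\mathbb C$ be the closed disk with center $\frac{a+d}2+\frac{c-b}2 i$ and radius $\sqrt{(\frac{a-d}2)^2+(\frac{b+c}2)^2}$. For a continuous $h:[a,b]\to M_2(\mathbb R)$ let $$\mathrm{Lexp}(h\,d\theta|_{[a,b]})=\sum_{n\ge0}\int_{a\le s_1\le\dots\le s_n\le b}h(s_n)\cdots h(s_1)\,ds_1\cdots ds_n$$ be its time-ordered exponential (later factors on the left). For $p_1,p_2\ge0$, $t\in\mathbb R$, $\tilde F\in\tilde{\mathbb K}$ put $$NW(p_1,p_2,t,\tilde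 F)=e^{p_1\cos t}\Bigl(\exp((p_1+p_2)\sin t\,\tilde I)\Bigl(\cosh(p_2\cos t)\,\mathrm{Id}-\tfrac{\sinh(p_2\cos t)}{\cos t}\sin t\,\tilde I\Bigr)+\tfrac{\sinh(p_2\cos t)}{\cos t}\tilde F\Bigr),$$ where $\frac{\sinh(p_2\cos t)}{\cos t}$ means $p_2$ if $\cos t=0$. **Theorem.** Let $A\in M_2(\mathbb R)$ satisfy $CD(A)\subset\exp D(0,\pi)$. Let $p$ be the smallest real number such that $CD(A)\subset\exp\bar D(0,p)$, and suppose that $CD(A)$ touches $\exp\partial\bar D(0,p)$ at $e^{p(\cos t+i\sin t)}$, i.e. contains this point. Then there are $p_1,p_2\ge0$ with $p=p_1+p_2$ and $\tilde F\in\tilde{\mathbb K}$ such that $$\begin{aligned}A&=NW(p_1,p_2,t,\tilde F)\\&=\mathrm{Lexp}\bigl(p_1\exp(t\tilde I)+p_2\exp(2p\theta\sin t\,\tilde I)\tilde F\;d\theta|_{[-1/2,1/2]}\bigr)\\&=\mathrm{Lexp}\bigl(\exp(t\tilde I)\,d\theta|_{[0,p_1]}\bigr)\,\mathrm{Lexp}\bigl(\exp((2\theta-p_1-p_2)\sin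 t\,\tilde I)\tilde F\,d\theta|_{[0,p_2]}\bigr)\\&=\mathrm{Lexp}\bigl(\exp((2\theta+p_1-p_2)\sin t\,\tilde I)\tilde F\,d\theta|_{[0,p_2]}\bigr)\,\mathrm{Lexp}\bigl(\exp(t\tilde I)\,d\theta|_{[0,p_1]}\bigr).\end{aligned}$$ Moreover, for any $p_1,p_2\ge0$ with $p=p_1+p_2$ and any $\tilde F\in\tilde{\mathbb K}$ with $A=NW(p_1,p_2,t,\tilde F)$: 1. $p_1=p_2=0$ if and only if $A=\mathrm{Id}$. 2. $p_1>0$, $p_2=0$ if and only if $A\ne\mathrm{Id}$ and $CD(A)$ is a single point; in this case $A=NW(p_1,p_2,t,\tilde F')$ for every $\tilde F'\in\tilde{\mathbb K}$. 3. $p_1=0$, $p_2>0$ if and only if $A\ne\mathrm{Id}$ and $CD(A)$ is maximal under inclusion among the closed disks (points included) contained in $\exp\bar D(0,p)$. In this case also $A=NW(p_1,p_2,\pi-t,\tilde F)$, and whenever $A=NW(p_1',p_2',t',\tilde F')$ with $p_1',p_2'\ge0$, $p_1'+p_2'<\pi$, $\tilde F'\in\tilde{\mathbb K}$, one has $p_1'=p_1$,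 $p_2'=p_2$, $\tilde F'=\tilde F$, and $t'\equiv t$ or $t'\equiv\pi-t$ mod $2\pi$. 4. If $p_1,p_2>0$, then whenever $A=NW(p_1',p_2',t',\tilde F')$ with $p_1',p_2'\ge0$, $p_1'+p_2'<\pi$, $\tilde F'\in\tilde{\mathbb K}$, one has $p_1'=p_1$, $p_2'=p_2$, $\tilde F'=\tilde F$ and $t'\equiv t$ mod $2\pi$. -/

import Mathlib

noncomputable section

/-- The chiral disk of a real `2 × 2` matrix `[a, b; c, d]`: the closed disk in `ℂ` with center
`(a + d) / 2 + i (c - b) / 2` and radius `√(((a - d) / 2)² + ((b + c) / 2)²)`. -/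
def chiralDisk (A : Matrix (Fin 2) (Fin 2) ℝ) : Set ℂ :=
  Metric.closedBall (⟨(A 0 0 + A 1 1) / 2, (A 1 0 - A 0 1) / 2⟩ : ℂ)
    (Real.sqrt (((A 0 0 - A 1 1) / 2) ^ 2 + ((A 0 1 + A 1 0) / 2) ^ 2))

/-- The skew-quaternionic unit `Ĩ`. -/
def matI : Matrix (Fin 2) (Fin 2) ℝ := !![0, -1; 1, 0]

/-- The skew-quaternionic unit `J̃`. -/
def matJ : Matrix (Fin 2) (Fin 2) ℝ := !![1, 0; 0, -1]

/-- The skew-quaternionic unit `K̃`. -/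
def matK : Matrix (Fin 2) (Fin 2) ℝ := !![0, 1; 1, 0]

/-- The set of the conjugates of `K̃` by orthogonal matrices. -/
def conjK : Set (Matrix (Fin 2) (Fin 2) ℝ) :=
  {F | ∃ β ∈ Set.Ico (0 : ℝ) (2 * Real.pi), F = -Real.sin β • matJ + Real.cos β • matK}

/-- `exp (α Ĩ)`, with the matrix exponential. -/
def expI (α : ℝ) : Matrix (Fin 2) (Fin 2) ℝ := NormedSpace.exp (α • matI)

/-- `sinh (q x) / x`, understood as `q` for `x = 0`. -/
def sinhQuot (q x : ℝ) : ℝ := if x = 0 then q else Real.sinh (q * x) / x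

/-- The arithmetic normal form. -/
def normalForm (p₁ p₂ t : ℝ) (F : Matrix (Fin 2) (Fin 2) ℝ) : Matrix (Fin 2) (Fin 2) ℝ :=
  Real.exp (p₁ * Real.cos t) •
    (expI ((p₁ + p₂) * Real.sin t) *
        (Real.cosh (p₂ * Real.cos t) • (1 : Matrix (Fin 2) (Fin 2) ℝ)
          - (sinhQuot p₂ (Real.cos t) * Real.sin t) • matI)
      + sinhQuot p₂ (Real.cos t) • F)

/-- The `n`-th ordered iterated integral
`∫_{a ≤ s₁ ≤ ⋯ ≤ sₙ ≤ x} h(sₙ) ⋯ h(s₁) ds₁ ⋯ dsₙ` (integrals are taken entrywise). -/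
def orderedIntegral (h : ℝ → Matrix (Fin 2) (Fin 2) ℝ) (a : ℝ) :
    ℕ → ℝ → Matrix (Fin 2) (Fin 2) ℝ
  | 0, _ => 1
  | n + 1, x => Matrix.of fun i j => ∫ s in a..x, (h s * orderedIntegral h a n s) i j

/-- The left time-ordered exponential of the matrix valued measure `h(θ) dθ` on `[a, b]`:
the sum of all ordered iterated integrals, where later factors stand to the left. -/
def leftExp (h : ℝ → Matrix (Fin 2) (Fin 2) ℝ) (a b : ℝ) : Matrix (Fin 2) (Fin 2) ℝ :=
  ∑' n : ℕ, orderedIntegral h a n b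

/-- `D` is a maximal element among the closed disks (points included) contained in `S`. -/
def IsMaximalDisk (S D : Set ℂ) : Prop :=
  Maximal (fun D' : Set ℂ => (∃ (z : ℂ) (r : ℝ), 0 ≤ r ∧ D' = Metric.closedBall z r) ∧ D' ⊆ S) D

end

/-! Write `A` as the real-linear map `v ↦ z v + w v̄`. Its chiral disk has center `z` and radius
`‖w‖`, and only the phase of `w` is lost. The phase is what `F` supplies, so existence and
uniqueness of the normal form become statements about disks in `ℂ`.

The disk of `NW(p₁, p₂, t, F)` passes through `γ(t) = exp (p e^{it})`, `p = p₁ + p₂`, and its center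
lies on the inner normal of `exp (∂D(0, p))` at `γ(t)` (`normalCenter_eq`). For fixed `p` and `t`
its radius increases strictly with `p₂`, from `0` to `R = sinh (p cos t) / cos t`. So these disks
form the pencil tangent at `γ(t)`, up to a largest one, and three facts suffice.

(a) The largest disk lies in `exp (D̄(0, p))` and meets the boundary curve exactly at `γ(t)` and
`γ(π - t)`. Indeed `‖γ(τ) - c‖² - R²` is a positive multiple of `contactFun p τ t`, which is
positive unless `sin τ = sin t` (`contactFun_pos`). Connectedness turns avoidance of the curve into
inclusion (`ball_normalCenter_subset`).

(b) A disk in `exp (D̄(0, p))` through `γ(t)` is tangent there (`center_eq_of_subset`).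

(c) Its radius is at most `R`: a larger one would swallow `γ(π - t)`, or, when the two contact
points merge (`cos t = 0`), violate a curvature bound (`radius_le_of_subset`).

Existence follows by the intermediate value theorem in `p₂`. For uniqueness, `p` is read off from
the inclusion, `t` from the contact points (two for the largest disk, one otherwise), `p₂` from the
radius, and `F` from `w` if the radius is nonzero.

The time-ordered exponentials all come from one explicit solution of a linear differential equation
(`leftExp_chiralMatrix`). -/

/-! ### Real `2 × 2` matrices as pairs of complex numbers -/

/-- The matrix of the real-linear map `v ↦ z v + w v̄` of `ℂ`. -/
def chiralMatrix (z w : ℂ) : Matrix (Fin 2) (Fin 2) ℝ :=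
  !![z.re + w.re, w.im - z.im; z.im + w.im, z.re - w.re]

theorem exists_eq_chiralMatrix (A : Matrix (Fin 2) (Fin 2) ℝ) :
    ∃ z w : ℂ, A = chiralMatrix z w := by
  refine ⟨⟨(A 0 0 + A 1 1) / 2, (A 1 0 - A 0 1) / 2⟩, ⟨(A 0 0 - A 1 1) / 2, (A 0 1 + A 1 0) / 2⟩,
    ?_⟩
  ext i j
  fin_cases i <;> fin_cases j <;> simp [chiralMatrix] <;> ring

theorem chiralMatrix_inj {z w z' w' : ℂ} :
    chiralMatrix z w = chiralMatrix z' w' ↔ z = z' ∧ w = w' := by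
  constructor
  · intro h
    have h00 := congrFun (congrFun h 0) 0
    have h01 := congrFun (congrFun h 0) 1
    have h10 := congrFun (congrFun h 1) 0
    have h11 := congrFun (congrFun h 1) 1
    simp only [chiralMatrix, Matrix.of_apply, Matrix.cons_val', Matrix.cons_val_zero,
      Matrix.cons_val_one, Matrix.cons_val_fin_one] at h00 h01 h10 h11
    constructor <;> apply Complex.ext <;> linarith
  · rintro ⟨rfl, rfl⟩
    rfl

theorem chiralMatrix_mul (z w z' w' : ℂ) :
    chiralMatrix z w * chiralMatrix z' w' =
      chiralMatrix (z * z' + w * (starRingEnd ℂ) w') (z * w' + w * (starRingEnd ℂ) z') := by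
  ext i j
  fin_cases i <;> fin_cases j <;> simp [chiralMatrix, Matrix.mul_apply, Fin.sum_univ_two] <;> ring

theorem chiralMatrix_add (z w z' w' : ℂ) :
    chiralMatrix z w + chiralMatrix z' w' = chiralMatrix (z + z') (w + w') := by
  ext i j
  fin_cases i <;> fin_cases j <;> simp [chiralMatrix] <;> ring

theorem chiralMatrix_sub (z w z' w' : ℂ) :
    chiralMatrix z w - chiralMatrix z' w' = chiralMatrix (z - z') (w - w') := by
  ext i j
  fin_cases i <;> fin_cases j <;> simp [chiralMatrix] <;> ring

theorem smul_chiralMatrix (r : ℝ) (z w : ℂ) :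
    r • chiralMatrix z w = chiralMatrix (r * z) (r * w) := by
  ext i j
  fin_cases i <;> fin_cases j <;> simp [chiralMatrix] <;> ring

theorem chiralMatrix_one : (1 : Matrix (Fin 2) (Fin 2) ℝ) = chiralMatrix 1 0 := by
  ext i j
  fin_cases i <;> fin_cases j <;> simp [chiralMatrix]

theorem matI_eq_chiralMatrix : matI = chiralMatrix Complex.I 0 := by
  ext i j
  fin_cases i <;> fin_cases j <;> simp [chiralMatrix, matI]

theorem chiralDisk_chiralMatrix (z w : ℂ) :
    chiralDisk (chiralMatrix z w) = Metric.closedBall z ‖w‖ := by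
  have h : (⟨(chiralMatrix z w 0 0 + chiralMatrix z w 1 1) / 2,
      (chiralMatrix z w 1 0 - chiralMatrix z w 0 1) / 2⟩ : ℂ) = z := by
    apply Complex.ext
    · simp [chiralMatrix]
    · simp [chiralMatrix]
      ring
  rw [chiralDisk, h, Complex.norm_def, Complex.normSq_apply]
  congr 2
  simp [chiralMatrix]
  ring

/-- The embedding of `ℂ` as the algebra generated by `matI`. -/
def complexToMatrix : ℂ →+* Matrix (Fin 2) (Fin 2) ℝ where
  toFun z := chiralMatrix z 0
  map_one' := chiralMatrix_one.symm
  map_mul' z z' := by simp [chiralMatrix_mul]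
  map_zero' := by
    ext i j
    fin_cases i <;> fin_cases j <;> simp [chiralMatrix]
  map_add' z z' := by simp [chiralMatrix_add]

theorem continuous_complexToMatrix : Continuous complexToMatrix := by
  refine continuous_matrix fun i j => ?_
  fin_cases i <;> fin_cases j <;> simp [complexToMatrix, chiralMatrix] <;> fun_prop

theorem expI_eq_chiralMatrix (α : ℝ) :
    expI α = chiralMatrix (Complex.exp (α * Complex.I)) 0 := by
  let _ : NormedRing (Matrix (Fin 2) (Fin 2) ℝ) := Matrix.linftyOpNormedRing
  let _ : NormedAlgebra ℝ (Matrix (Fin 2) (Fin 2) ℝ) := Matrix.linftyOpNormedAlgebra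
  have h : NormedSpace.exp (complexToMatrix (α * Complex.I)) =
      complexToMatrix (NormedSpace.exp (α * Complex.I)) :=
    (NormedSpace.map_exp complexToMatrix continuous_complexToMatrix _).symm
  rw [expI, matI_eq_chiralMatrix, smul_chiralMatrix, Complex.exp_eq_exp_ℂ, mul_zero]
  exact h

theorem mem_conjK_iff (F : Matrix (Fin 2) (Fin 2) ℝ) :
    F ∈ conjK ↔ ∃ u : ℂ, ‖u‖ = 1 ∧ F = chiralMatrix 0 u := by
  have key (β : ℝ) : -Real.sin β • matJ + Real.cos β • matK =
      chiralMatrix 0 (Complex.I * Complex.exp (β * Complex.I)) := by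
    ext i j
    fin_cases i <;> fin_cases j <;>
      simp [chiralMatrix, matJ, matK, Complex.exp_ofReal_mul_I_re, Complex.exp_ofReal_mul_I_im]
  constructor
  · rintro ⟨β, -, rfl⟩
    exact ⟨_, by simp [Complex.norm_exp_ofReal_mul_I], key β⟩
  · rintro ⟨u, hu, rfl⟩
    set v : ℂ := -Complex.I * u
    have hv : ‖v‖ = 1 := by simp [v, hu]
    refine ⟨toIcoMod Real.two_pi_pos 0 v.arg, by simpa using toIcoMod_mem_Ico Real.two_pi_pos 0 _,
      ?_⟩
    have hper : Complex.exp ((toIcoMod Real.two_pi_pos 0 v.arg : ℝ) * Complex.I) = v := by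
      rw [toIcoMod]
      have h2 := Complex.norm_mul_exp_arg_mul_I v
      rw [hv, Complex.ofReal_one, one_mul] at h2
      conv_rhs => rw [← h2]
      rw [Complex.exp_eq_exp_iff_exists_int]
      refine ⟨-toIcoDiv Real.two_pi_pos 0 v.arg, ?_⟩
      push_cast [zsmul_eq_mul]
      ring
    rw [key, hper]
    congr 1
    change u = Complex.I * (-Complex.I * u)
    linear_combination u * Complex.I_mul_I

/-! ### The chiral disk of a normal form -/

/-- The center of the chiral disk of a normal form. -/
noncomputable def normalCenter (p₁ p₂ t : ℝ) : ℂ :=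
  Real.exp (p₁ * Real.cos t) * (Complex.exp (((p₁ + p₂) * Real.sin t : ℝ) * Complex.I) *
    (Real.cosh (p₂ * Real.cos t) - (sinhQuot p₂ (Real.cos t) * Real.sin t : ℝ) * Complex.I))

/-- The radius of the chiral disk of a normal form. -/
noncomputable def normalRadius (p₁ p₂ t : ℝ) : ℝ :=
  Real.exp (p₁ * Real.cos t) * sinhQuot p₂ (Real.cos t)

theorem normalForm_chiralMatrix (p₁ p₂ t : ℝ) (u : ℂ) :
    normalForm p₁ p₂ t (chiralMatrix 0 u) =
      chiralMatrix (normalCenter p₁ p₂ t) (normalRadius p₁ p₂ t * u) := by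
  rw [normalForm, expI_eq_chiralMatrix, matI_eq_chiralMatrix, chiralMatrix_one]
  simp only [smul_chiralMatrix, chiralMatrix_sub, chiralMatrix_mul, chiralMatrix_add]
  rw [chiralMatrix_inj]
  constructor
  · simp [normalCenter]
  · simp [normalRadius, mul_assoc]

/-! ### Time-ordered exponentials and linear differential equations -/

/-- Stated for any sequence obeying the recursion, because it bounds both the ordered integrals and
the remainders of their sum. The factor `2` counts the summands in an entry of a product. -/
theorem abs_le_of_iterated_integral {h : ℝ → Matrix (Fin 2) (Fin 2) ℝ}
    {E : ℕ → ℝ → Matrix (Fin 2) (Fin 2) ℝ} {a b M K : ℝ}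
    (hM : ∀ θ ∈ Set.Icc a b, ∀ i j, |h θ i j| ≤ M)
    (hK : ∀ θ ∈ Set.Icc a b, ∀ i j, |E 0 θ i j| ≤ K)
    (hE : ∀ n, ∀ x ∈ Set.Icc a b, ∀ i j, E (n + 1) x i j = ∫ s in a..x, (h s * E n s) i j)
    (n : ℕ) : ∀ x ∈ Set.Icc a b, ∀ i j,
      |E n x i j| ≤ K * ((2 * M * (x - a)) ^ n / n.factorial) := by
  induction n with
  | zero => simpa using hK
  | succ n ih =>
    intro x hx i j
    rw [hE n x hx]
    have hM0 : 0 ≤ M := (abs_nonneg _).trans (hM x hx 0 0)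
    have hderiv (s : ℝ) : HasDerivAt
        (fun s => K * ((2 * M * (s - a)) ^ (n + 1) / (n + 1).factorial))
        (2 * M * (K * ((2 * M * (s - a)) ^ n / n.factorial))) s := by
      have h1 : HasDerivAt (fun s : ℝ => 2 * M * (s - a)) (2 * M) s := by
        simpa using ((hasDerivAt_id s).sub_const a).const_mul (2 * M)
      convert! ((h1.pow (n + 1)).div_const ((n + 1).factorial : ℝ)).const_mul K using 1
      have h2 : (n.factorial : ℝ) ≠ 0 := by positivity
      rw [Nat.factorial_succ]
      push_cast
      field_simp
    have hcont : Continuous fun s : ℝ => 2 * M * (K * ((2 * M * (s - a)) ^ n / n.factorial)) := by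
      fun_prop
    have hint := intervalIntegral.integral_eq_sub_of_hasDerivAt (a := a) (b := x)
      (fun s _ => hderiv s) (hcont.intervalIntegrable a x)
    have hval : ∫ s in a..x, 2 * M * (K * ((2 * M * (s - a)) ^ n / n.factorial)) =
        K * ((2 * M * (x - a)) ^ (n + 1) / (n + 1).factorial) := by
      rw [hint]
      simp
    rw [← hval, ← Real.norm_eq_abs]
    refine intervalIntegral.norm_integral_le_of_norm_le hx.1
      (Filter.Eventually.of_forall fun s hs => ?_) (hcont.intervalIntegrable a x)
    have hs' : s ∈ Set.Icc a b := ⟨hs.1.le, hs.2.trans hx.2⟩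
    rw [Matrix.mul_apply, Fin.sum_univ_two, Real.norm_eq_abs]
    calc |h s i 0 * E n s 0 j + h s i 1 * E n s 1 j|
        ≤ |h s i 0| * |E n s 0 j| + |h s i 1| * |E n s 1 j| := by
          rw [← abs_mul, ← abs_mul]
          exact abs_add_le _ _
      _ ≤ M * (K * ((2 * M * (s - a)) ^ n / n.factorial)) +
          M * (K * ((2 * M * (s - a)) ^ n / n.factorial)) := by
          gcongr
          · exact hM s hs' i 0
          · exact ih s hs' 0 j
          · exact hM s hs' i 1
          · exact ih s hs' 1 j
      _ = _ := by ring

theorem continuous_mul_apply {h E : ℝ → Matrix (Fin 2) (Fin 2) ℝ}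
    (hh : ∀ i j, Continuous fun θ => h θ i j) (hE : ∀ i j, Continuous fun θ => E θ i j)
    (i j : Fin 2) : Continuous fun θ => (h θ * E θ) i j := by
  simp only [Matrix.mul_apply, Fin.sum_univ_two]
  exact ((hh i 0).mul (hE 0 j)).add ((hh i 1).mul (hE 1 j))

theorem continuous_orderedIntegral {h : ℝ → Matrix (Fin 2) (Fin 2) ℝ}
    (hh : ∀ i j, Continuous fun θ => h θ i j) (a : ℝ) (n : ℕ) :
    ∀ i j, Continuous fun θ => orderedIntegral h a n θ i j := by
  induction n with
  | zero => exact fun i j => continuous_const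
  | succ n ih =>
    intro i j
    exact intervalIntegral.continuous_primitive
      (fun _ _ => (continuous_mul_apply hh ih i j).intervalIntegrable _ _) a

/-- The time-ordered exponential is computed by any solution of the linear equation `U' = h U`
starting at the identity. -/
theorem leftExp_eq_of_hasDerivAt {h U : ℝ → Matrix (Fin 2) (Fin 2) ℝ} {a b : ℝ} (hab : a ≤ b)
    (hh : ∀ i j, Continuous fun θ => h θ i j)
    (hU : ∀ θ i j, HasDerivAt (fun θ => U θ i j) ((h θ * U θ) i j) θ) (ha : U a = 1) :
    leftExp h a b = U b := by
  have hUc (i j) : Continuous fun θ => U θ i j :=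
    continuous_iff_continuousAt.2 fun θ => (hU θ i j).continuousAt
  have hbound {f : ℝ → Matrix (Fin 2) (Fin 2) ℝ} (hf : ∀ i j, Continuous fun θ => f θ i j) :
      ∃ M, ∀ θ ∈ Set.Icc a b, ∀ i j, |f θ i j| ≤ M := by
    have h1 (i j) : ∃ M, ∀ θ ∈ Set.Icc a b, ‖f θ i j‖ ≤ M :=
      isCompact_Icc.exists_bound_of_continuousOn (hf i j).continuousOn
    choose M hM using h1
    refine ⟨∑ i, ∑ j, |M i j|, fun θ hθ i j => (hM i j θ hθ).trans ((le_abs_self _).trans ?_)⟩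
    exact (Finset.single_le_sum (f := fun j => |M i j|) (fun _ _ => abs_nonneg _)
      (Finset.mem_univ j)).trans (Finset.single_le_sum (f := fun i => ∑ j, |M i j|)
      (fun _ _ => Finset.sum_nonneg fun _ _ => abs_nonneg _) (Finset.mem_univ i))
  obtain ⟨M, hM⟩ := hbound hh
  obtain ⟨K, hK⟩ := hbound hUc
  have hb : b ∈ Set.Icc a b := ⟨hab, le_rfl⟩
  have hI := abs_le_of_iterated_integral (E := orderedIntegral h a) (K := 1) hM
    (fun θ _ i j => by
      rw [orderedIntegral, Matrix.one_apply]
      split_ifs <;> simp) (fun n x _ i j => rfl)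
  -- The remainder of the partial sums obeys the same recursion as the terms, by the integrated form
  -- of `U' = h U`, so it tends to zero like the terms of an exponential series.
  have hR := abs_le_of_iterated_integral
    (E := fun n x => U x - ∑ k ∈ Finset.range n, orderedIntegral h a k x) (K := K) hM
    (by simpa using hK) (by
      intro n x _ i j
      have hFTC : ∫ s in a..x, (h s * U s) i j = U x i j - U a i j :=
        intervalIntegral.integral_eq_sub_of_hasDerivAt (fun s _ => hU s i j)
          ((continuous_mul_apply hh hUc i j).intervalIntegrable a x)
      have hk (k) : IntervalIntegrable (fun s => (h s * orderedIntegral h a k s) i j)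
          MeasureTheory.volume a x :=
        (continuous_mul_apply hh (continuous_orderedIntegral hh a k) i j).intervalIntegrable a x
      simp only [Matrix.mul_sub, Matrix.mul_sum, Matrix.sub_apply, Matrix.sum_apply]
      rw [intervalIntegral.integral_sub
        ((continuous_mul_apply hh hUc i j).intervalIntegrable a x)
        ((continuous_finsetSum _ fun k _ => continuous_mul_apply hh
          (continuous_orderedIntegral hh a k) i j).intervalIntegrable a x),
        intervalIntegral.integral_finsetSum
        fun k _ => hk k, hFTC, Finset.sum_range_succ', ha]
      simp only [orderedIntegral, Matrix.of_apply]
      ring)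
  refine HasSum.tsum_eq (Pi.hasSum.2 fun i => Pi.hasSum.2 fun j => ?_)
  have hfac := Real.summable_pow_div_factorial (2 * M * (b - a))
  have hsum : Summable fun n => orderedIntegral h a n b i j :=
    Summable.of_norm_bounded (hfac.mul_left 1) fun n => hI n b hb i j
  rw [hsum.hasSum_iff_tendsto_nat]
  have h0 : Filter.Tendsto (fun n => U b i j - ∑ k ∈ Finset.range n, orderedIntegral h a k b i j)
      Filter.atTop (nhds 0) := by
    refine squeeze_zero_norm (fun n => ?_)
      (by simpa using (hfac.tendsto_atTop_zero).const_mul K)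
    simpa [Matrix.sub_apply, Matrix.sum_apply] using hR n b hb i j
  simpa using (tendsto_const_nhds (x := U b i j)).sub h0

theorem mul_sinhQuot (q x : ℝ) : x * sinhQuot q x = Real.sinh (q * x) := by
  unfold sinhQuot
  split_ifs with h
  · simp [h]
  · field_simp

theorem hasDerivAt_sinhQuot (q x θ : ℝ) :
    HasDerivAt (fun θ => sinhQuot (q * θ) x) (q * Real.cosh (q * θ * x)) θ := by
  unfold sinhQuot
  split_ifs with h
  · simpa [h] using (hasDerivAt_id θ).const_mul q
  · have h1 : HasDerivAt (fun θ : ℝ => q * θ * x) (q * x) θ := by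
      simpa using ((hasDerivAt_id θ).const_mul q).mul_const x
    convert! h1.sinh.div_const x using 1
    field_simp

theorem hasDerivAt_chiralMatrix {Z W : ℝ → ℂ} {z w : ℂ} {θ : ℝ} (hZ : HasDerivAt Z z θ)
    (hW : HasDerivAt W w θ) (i j : Fin 2) :
    HasDerivAt (fun θ => chiralMatrix (Z θ) (W θ) i j) (chiralMatrix z w i j) θ := by
  have hre {f : ℝ → ℂ} {f' : ℂ} (hf : HasDerivAt f f' θ) : HasDerivAt (fun θ => (f θ).re) f'.re θ :=
    Complex.reCLM.hasFDerivAt.comp_hasDerivAt θ hf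
  have him {f : ℝ → ℂ} {f' : ℂ} (hf : HasDerivAt f f' θ) : HasDerivAt (fun θ => (f θ).im) f'.im θ :=
    Complex.imCLM.hasFDerivAt.comp_hasDerivAt θ hf
  fin_cases i <;> fin_cases j
  · exact (hre hZ).add (hre hW)
  · exact (him hW).sub (him hZ)
  · exact (him hZ).add (him hW)
  · exact (hre hZ).sub (hre hW)

theorem hasDerivAt_cexp_mul_I {f : ℝ → ℝ} {f' θ : ℝ} (hf : HasDerivAt f f' θ) :
    HasDerivAt (fun θ => Complex.exp ((f θ : ℝ) * Complex.I))
      (Complex.exp ((f θ : ℝ) * Complex.I) * (f' * Complex.I)) θ :=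
  (hf.ofReal_comp.mul_const Complex.I).cexp

theorem conj_cexp_mul_I (x : ℝ) : (starRingEnd ℂ) (Complex.exp (x * Complex.I)) =
    Complex.exp ((-x : ℝ) * Complex.I) := by
  rw [← Complex.exp_conj]
  simp

/-- In a frame rotating with speed `(p₁ + p₂) sin t` the equation has constant coefficients, hence
an explicit solution. The interval and the phase `v` are free so that all three time-ordered
exponentials of the theorem are instances. -/
theorem leftExp_chiralMatrix (p₁ p₂ t : ℝ) {a b : ℝ} (hab : a ≤ b) {v : ℂ} (hv : ‖v‖ = 1) :
    leftExp (fun θ => chiralMatrix (p₁ * Complex.exp (t * Complex.I))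
      (p₂ * Complex.exp ((2 * ((p₁ + p₂) * Real.sin t) * θ : ℝ) * Complex.I) * v)) a b =
    chiralMatrix (normalCenter (p₁ * (b - a)) (p₂ * (b - a)) t)
      (normalRadius (p₁ * (b - a)) (p₂ * (b - a)) t *
        (Complex.exp (((p₁ + p₂) * Real.sin t * (a + b) : ℝ) * Complex.I) * v)) := by
  set ω : ℝ := (p₁ + p₂) * Real.sin t with hω
  rw [leftExp_eq_of_hasDerivAt (U := fun θ => chiralMatrix
      ((Real.exp (p₁ * Real.cos t * (θ - a)) : ℝ) *
        (Complex.exp ((ω * (θ - a) : ℝ) * Complex.I) * ((Real.cosh (p₂ * Real.cos t * (θ - a)) : ℝ)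
          - Real.sin t * (sinhQuot (p₂ * (θ - a)) (Real.cos t) : ℝ) * Complex.I)))
      ((Real.exp (p₁ * Real.cos t * (θ - a)) : ℝ) *
        (sinhQuot (p₂ * (θ - a)) (Real.cos t) : ℝ) *
        (Complex.exp ((ω * (a + θ) : ℝ) * Complex.I) * v))) hab]
  · rw [chiralMatrix_inj, normalCenter, normalRadius]
    constructor
    · push_cast
      rw [hω]
      push_cast
      ring_nf
    · push_cast
      ring_nf
  · intro i j
    fin_cases i <;> fin_cases j <;> simp [chiralMatrix] <;> fun_prop
  · intro θ i j
    rw [chiralMatrix_mul]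
    have hlin (k : ℝ) : HasDerivAt (fun θ : ℝ => k * (θ - a)) k θ := by
      simpa using ((hasDerivAt_id θ).sub_const a).const_mul k
    have hE := (hlin (p₁ * Real.cos t)).exp.ofReal_comp
    have hC := (hlin (p₂ * Real.cos t)).cosh.ofReal_comp
    have hS : HasDerivAt (fun θ => sinhQuot (p₂ * (θ - a)) (Real.cos t))
        (p₂ * Real.cosh (p₂ * (θ - a) * Real.cos t)) θ :=
      HasDerivAt.comp_sub_const θ a (hasDerivAt_sinhQuot p₂ (Real.cos t) (θ - a))
    have hS := hS.ofReal_comp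
    have hX := hasDerivAt_cexp_mul_I (hlin ω)
    have hY := hasDerivAt_cexp_mul_I
      (show HasDerivAt (fun θ : ℝ => ω * (a + θ)) ω θ by
        simpa using ((hasDerivAt_id θ).const_add a).const_mul ω)
    have hsinh := mul_sinhQuot (p₂ * (θ - a)) (Real.cos t)
    -- The phase of the generator splits into the phases of the two components of `U`. With
    -- conjugates as separate variables, both equations become polynomial identities modulo the unit
    -- relations.
    have hT : Complex.exp ((2 * ω * θ : ℝ) * Complex.I) =
        Complex.exp ((ω * (θ - a) : ℝ) * Complex.I) *
          Complex.exp ((ω * (a + θ) : ℝ) * Complex.I) := by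
      rw [← Complex.exp_add]
      congr 1
      push_cast
      ring
    have hexp : Complex.exp (t * Complex.I) = Real.cos t + Real.sin t * Complex.I := by
      rw [Complex.exp_mul_I]
      simp
    have hunit (x : ℝ) : Complex.exp (x * Complex.I) *
        (starRingEnd ℂ) (Complex.exp (x * Complex.I)) = 1 := by
      rw [Complex.mul_conj, Complex.normSq_eq_norm_sq, Complex.norm_exp_ofReal_mul_I]
      simp
    have hXX := hunit (ω * (θ - a))
    have hYY := hunit (ω * (a + θ))
    have hvv : v * (starRingEnd ℂ) v = 1 := by
      rw [Complex.mul_conj, Complex.normSq_eq_norm_sq, hv]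
      simp
    have hcs : ((Real.cos t : ℝ) : ℂ) ^ 2 + ((Real.sin t : ℝ) : ℂ) ^ 2 = 1 := by
      exact_mod_cast Real.cos_sq_add_sin_sq t
    have hI := Complex.I_mul_I
    have hωc : (ω : ℂ) = (p₁ + p₂) * (Real.sin t : ℝ) := by
      rw [hω]
      push_cast
      rfl
    rw [show p₂ * (θ - a) * Real.cos t = p₂ * Real.cos t * (θ - a) by ring] at hsinh hS
    rw [← hsinh] at hC
    refine hasDerivAt_chiralMatrix ?_ ?_ i j
    · convert! hE.fun_mul (hX.fun_mul
        (hC.fun_sub ((hS.const_mul ((Real.sin t : ℝ) : ℂ)).mul_const Complex.I))) using 1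
      rw [hT, hexp]
      simp only [map_mul, Complex.conj_ofReal]
      generalize Complex.exp ((ω * (θ - a) : ℝ) * Complex.I) = X at hXX ⊢
      generalize Complex.exp ((ω * (a + θ) : ℝ) * Complex.I) = Y at hYY ⊢
      generalize (starRingEnd ℂ) X = X' at *
      generalize (starRingEnd ℂ) Y = Y' at *
      generalize (starRingEnd ℂ) v = v' at *
      generalize Real.cosh _ = C
      generalize Real.exp _ = E
      generalize sinhQuot _ _ = S
      simp only [Complex.ofReal_mul, hωc]
      linear_combination (p₂ * X * E * S) * v * v' * hYY + (p₂ * X * E * S) * hvv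
        - (p₂ * X * E * S) * hcs + (p₂ * X * E * S) * (Real.sin t : ℂ) ^ 2 * hI
    · convert! (hE.fun_mul hS).fun_mul (hY.mul_const v) using 1
      rw [hT, hexp]
      simp only [map_mul, map_sub, Complex.conj_ofReal, Complex.conj_I]
      generalize Complex.exp ((ω * (θ - a) : ℝ) * Complex.I) = X at hXX ⊢
      generalize Complex.exp ((ω * (a + θ) : ℝ) * Complex.I) = Y at hYY ⊢
      generalize (starRingEnd ℂ) X = X' at *
      generalize (starRingEnd ℂ) Y = Y' at *
      generalize (starRingEnd ℂ) v = v' at *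
      generalize Real.cosh _ = C
      generalize Real.exp _ = E
      generalize sinhQuot _ _ = S
      simp only [Complex.ofReal_mul, hωc]
      linear_combination (p₂ * Y * v * E) * (C + Real.sin t * S * Complex.I) * hXX
  · simp [sinhQuot, chiralMatrix_one]

/-! ### The quotient `sinh (q x) / x` -/

theorem continuous_sinhQuot (q : ℝ) : Continuous (sinhQuot q) := by
  have hf : Differentiable ℝ fun x : ℝ => Real.sinh (q * x) := by fun_prop
  have hd : HasDerivAt (fun x : ℝ => Real.sinh (q * x)) q 0 := by
    simpa using (((hasDerivAt_id (0 : ℝ)).const_mul q).sinh)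
  have heq : sinhQuot q = dslope (fun x : ℝ => Real.sinh (q * x)) 0 := by
    ext x
    by_cases hx : x = 0
    · simp [sinhQuot, hx, hd.deriv]
    · simp [sinhQuot, hx, dslope_of_ne, slope_def_field]
  rw [heq, continuous_iff_continuousAt]
  intro x
  by_cases hx : x = 0
  · rw [hx, continuousAt_dslope_same]
    exact hf 0
  · rw [continuousAt_dslope_of_ne hx]
    exact (hf x).continuousAt

theorem sinhQuot_neg (q x : ℝ) : sinhQuot q (-x) = sinhQuot q x := by
  simp [sinhQuot]

theorem sinhQuot_abs (q x : ℝ) : sinhQuot q |x| = sinhQuot q x := by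
  rcases abs_choice x with h | h <;> rw [h]
  exact sinhQuot_neg q x

theorem hasDerivAt_sinhQuot_of_ne {q x : ℝ} (hx : x ≠ 0) :
    HasDerivAt (sinhQuot q) ((q * Real.cosh (q * x) * x - Real.sinh (q * x)) / x ^ 2) x := by
  have h1 : HasDerivAt (fun x : ℝ => q * x) q x := by
    simpa using (hasDerivAt_id x).const_mul q
  have h2 := h1.sinh.fun_div (hasDerivAt_id x) hx
  refine (h2.congr_of_eventuallyEq ?_).congr_deriv ?_
  · filter_upwards [isOpen_ne.mem_nhds hx] with y hy
    simp only [sinhQuot, if_neg hy, id]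
  · simp only [id]
    ring

theorem sinhQuot_pos {q : ℝ} (hq : 0 < q) (x : ℝ) : 0 < sinhQuot q x := by
  rw [← sinhQuot_abs, sinhQuot]
  split_ifs with h
  · exact hq
  · have : 0 < |x| := lt_of_le_of_ne (abs_nonneg x) (Ne.symm h)
    have := Real.sinh_pos_iff.2 (mul_pos hq this)
    positivity

theorem sinh_lt_mul_cosh {x : ℝ} (hx : 0 < x) : Real.sinh x < x * Real.cosh x := by
  have hmono : StrictMonoOn (fun x : ℝ => x * Real.cosh x - Real.sinh x) (Set.Ici 0) := by
    refine strictMonoOn_of_deriv_pos (convex_Ici 0) (by fun_prop) fun y hy => ?_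
    rw [interior_Ici] at hy
    have h := ((hasDerivAt_id y).fun_mul (Real.hasDerivAt_cosh y)).fun_sub (Real.hasDerivAt_sinh y)
    simp only [id] at h
    rw [h.deriv]
    have := mul_pos (Set.mem_Ioi.1 hy) (Real.sinh_pos_iff.2 hy)
    linarith
  have := hmono Set.self_mem_Ici hx.le hx
  simp at this
  linarith

/-! ### Positivity of the contact function -/

/-- The function whose sign tells whether the point `exp (p e^{iτ})` lies outside of the disk
which touches the boundary of `exp (closedBall 0 p)` in the points `exp (p (± cos t + i sin t))`. -/
noncomputable def contactFun (p τ t : ℝ) : ℝ :=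
  Real.cosh (p * Real.cos τ)
    - Real.cosh (p * Real.cos t) * Real.cos (p * Real.sin τ - p * Real.sin t)
    + Real.sin t * sinhQuot p (Real.cos t) * Real.sin (p * Real.sin τ - p * Real.sin t)

theorem contactFun_neg (p τ t : ℝ) : contactFun p (-τ) (-t) = contactFun p τ t := by
  simp only [contactFun, Real.cos_neg, Real.sin_neg]
  rw [show p * -Real.sin τ - p * -Real.sin t = -(p * Real.sin τ - p * Real.sin t) by ring,
    Real.cos_neg, Real.sin_neg]
  ring

/-- The cosines enter only through even functions, so only the sines of the angles matter and both
angles can be moved to `[-π/2, π/2]`. -/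
theorem contactFun_arcsin (p τ t : ℝ) :
    contactFun p (Real.arcsin (Real.sin τ)) (Real.arcsin (Real.sin t)) = contactFun p τ t := by
  have hcos (x : ℝ) : Real.cos (Real.arcsin (Real.sin x)) = |Real.cos x| := by
    rw [Real.cos_arcsin, ← Real.abs_cos_eq_sqrt_one_sub_sin_sq]
  have hsin (x : ℝ) : Real.sin (Real.arcsin (Real.sin x)) = Real.sin x :=
    Real.sin_arcsin (Real.neg_one_le_sin x) (Real.sin_le_one x)
  have hcosh (x : ℝ) : Real.cosh (p * |x|) = Real.cosh (p * x) := by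
    rw [← Real.cosh_abs (p * |x|), ← Real.cosh_abs (p * x), abs_mul, abs_abs, abs_mul]
  simp only [contactFun, hcos, hsin, hcosh, sinhQuot_abs]

/-- The value is `M τ - M t` for a function `M` whose derivative at `σ` is `sin (p sin τ - p sin σ)`
times a multiple of `x cosh x - sinh x` with `x = p cos σ > 0`. The bound by `π` keeps the sine
positive. -/
theorem contactFun_pos_of_lt {p τ t : ℝ} (hp : 0 < p) (ht : -(Real.pi / 2) ≤ t) (htτ : t < τ)
    (hτ : τ ≤ Real.pi / 2) (hφ : p * Real.sin τ - p * Real.sin t ≤ Real.pi) :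
    0 < contactFun p τ t := by
  let M : ℝ → ℝ := fun σ =>
    Real.cosh (p * Real.cos σ) * Real.cos (p * Real.sin τ - p * Real.sin σ)
      - Real.sin σ * sinhQuot p (Real.cos σ) * Real.sin (p * Real.sin τ - p * Real.sin σ)
  have hMc : Continuous M := by
    have := continuous_sinhQuot p
    fun_prop
  have hM : StrictMonoOn M (Set.Icc t τ) := by
    refine strictMonoOn_of_deriv_pos (convex_Icc t τ) hMc.continuousOn fun σ hσ => ?_
    rw [interior_Icc] at hσ
    have hc : 0 < Real.cos σ := Real.cos_pos_of_mem_Ioo ⟨by linarith [hσ.1], by linarith [hσ.2]⟩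
    have h1 := Real.sin_lt_sin_of_lt_of_le_pi_div_two ht (hσ.2.le.trans hτ) hσ.1
    have h2 := Real.sin_lt_sin_of_lt_of_le_pi_div_two (ht.trans hσ.1.le) hτ hσ.2
    have hY : 0 < Real.sin (p * Real.sin τ - p * Real.sin σ) := by
      apply Real.sin_pos_of_pos_of_lt_pi <;> nlinarith
    have hgap := sinh_lt_mul_cosh (mul_pos hp hc)
    have hdS := (hasDerivAt_sinhQuot_of_ne (q := p) hc.ne').comp σ (Real.hasDerivAt_cos σ)
    have hdC := ((Real.hasDerivAt_cos σ).const_mul p).cosh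
    have hdY := ((Real.hasDerivAt_sin σ).const_mul p).const_sub (p * Real.sin τ)
    have hd := (hdC.fun_mul hdY.cos).fun_sub (((Real.hasDerivAt_sin σ).fun_mul hdS).fun_mul hdY.sin)
    have hval : deriv M σ = Real.sin (p * Real.sin τ - p * Real.sin σ) *
        ((p * Real.cos σ * Real.cosh (p * Real.cos σ) - Real.sinh (p * Real.cos σ)) /
          Real.cos σ ^ 2) := by
      rw [show deriv M σ = _ from hd.deriv]
      have hS : sinhQuot p (Real.cos σ) = Real.sinh (p * Real.cos σ) / Real.cos σ := by
        rw [sinhQuot, if_neg hc.ne']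
      simp only [Function.comp, hS]
      field_simp
      rw [Real.sin_sq]
      ring
    rw [hval]
    have : 0 < p * Real.cos σ * Real.cosh (p * Real.cos σ) - Real.sinh (p * Real.cos σ) := by
      linarith
    positivity
  have h := hM (Set.left_mem_Icc.2 htτ.le) (Set.right_mem_Icc.2 htτ.le) htτ
  simp only [M, sub_self, Real.cos_zero, Real.sin_zero, mul_one, mul_zero, sub_zero] at h
  rw [contactFun]
  linarith

theorem contactFun_pos_of_abs_le {p τ t : ℝ} (hp : 0 < p)
    (ht : t ∈ Set.Icc (-(Real.pi / 2)) (Real.pi / 2))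
    (hτ : τ ∈ Set.Icc (-(Real.pi / 2)) (Real.pi / 2)) (hne : τ ≠ t)
    (hφ : |p * Real.sin τ - p * Real.sin t| ≤ Real.pi) : 0 < contactFun p τ t := by
  rw [abs_le] at hφ
  rcases hne.lt_or_gt with h | h
  · rw [← contactFun_neg]
    refine contactFun_pos_of_lt hp (neg_le_neg ht.2) (neg_lt_neg h) (by linarith [hτ.1]) ?_
    simp only [Real.sin_neg]
    linarith
  · exact contactFun_pos_of_lt hp ht.1 h hτ.2 hφ.2

/-- Here the difference of the arguments leaves the range of the monotonicity argument. It is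
shifted by `2π` into `(0, π)` and compared with the contact function at the top point `τ = π/2`. -/
theorem contactFun_pos_of_lt_neg_pi {p τ t : ℝ} (hp : 0 < p) (hpπ : p < Real.pi)
    (ht : t ∈ Set.Icc (-(Real.pi / 2)) (Real.pi / 2))
    (hφ : p * Real.sin τ - p * Real.sin t < -Real.pi) : 0 < contactFun p τ t := by
  set φ := p * Real.sin τ - p * Real.sin t + 2 * Real.pi with hφdef
  have hsτ := mul_le_mul_of_nonneg_left (Real.neg_one_le_sin τ) hp.le
  have hst1 := mul_le_mul_of_nonneg_left (Real.sin_le_one t) hp.le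
  have hs : 0 < Real.sin t := by
    by_contra hs
    nlinarith
  have hcos : Real.cos (p * Real.sin τ - p * Real.sin t) = Real.cos φ := by
    rw [hφdef, Real.cos_add_two_pi]
  have hsin : Real.sin (p * Real.sin τ - p * Real.sin t) = Real.sin φ := by
    rw [hφdef, Real.sin_add_two_pi]
  have hφ0 : 0 < φ := by linarith
  have hφπ : φ < Real.pi := by linarith
  have hsφ := Real.sin_pos_of_pos_of_lt_pi hφ0 hφπ
  have hS := sinhQuot_pos hp (Real.cos t)
  have hC := Real.cosh_pos (p * Real.cos t)
  have h1 := Real.one_le_cosh (p * Real.cos τ)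
  rw [contactFun, hcos, hsin]
  rcases le_or_gt (Real.cos φ) 0 with hneg | hpos
  · have := mul_nonneg hC.le (neg_nonneg.2 hneg)
    have : 0 < Real.sin t * sinhQuot p (Real.cos t) * Real.sin φ := by positivity
    linarith
  · have hφ2 : φ < Real.pi / 2 := by
      by_contra hge
      have := Real.cos_nonpos_of_pi_div_two_le_of_le (not_lt.1 hge) (by linarith)
      linarith
    -- Since `p < π`, the angle `ψ` belonging to `π/2` is smaller than `φ`. Passing from `ψ` to `φ`
    -- lowers the cosine and raises the sine, and `cosh` is least at `π/2`.
    set ψ := p * Real.sin (Real.pi / 2) - p * Real.sin t with hψdef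
    have hψ0 : 0 ≤ ψ := by
      rw [hψdef, Real.sin_pi_div_two]
      linarith
    have hψφ : ψ < φ := by
      rw [hψdef, hφdef, Real.sin_pi_div_two]
      linarith
    have hbase : 0 ≤ contactFun p (Real.pi / 2) t := by
      by_cases hne : Real.pi / 2 = t
      · rw [contactFun, ← hne]
        simp
      · refine (contactFun_pos_of_abs_le hp ht ⟨by linarith [Real.pi_pos], le_rfl⟩ hne ?_).le
        rw [← hψdef, abs_of_nonneg hψ0]
        linarith
    rw [contactFun, ← hψdef, Real.cos_pi_div_two, mul_zero, Real.cosh_zero] at hbase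
    have hcl := Real.cos_lt_cos_of_nonneg_of_le_pi hψ0 hφπ.le hψφ
    have hsl := Real.sin_lt_sin_of_lt_of_le_pi_div_two (by linarith) hφ2.le hψφ
    have h2 := mul_lt_mul_of_pos_left hcl hC
    have h3 := mul_lt_mul_of_pos_left hsl (mul_pos hs hS)
    linarith

theorem contactFun_pos {p τ t : ℝ} (hp : 0 < p) (hpπ : p < Real.pi)
    (hne : Real.sin τ ≠ Real.sin t) : 0 < contactFun p τ t := by
  rw [← contactFun_arcsin]
  have ht := Real.arcsin_mem_Icc (Real.sin t)
  have hτ := Real.arcsin_mem_Icc (Real.sin τ)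
  have hne' : Real.arcsin (Real.sin τ) ≠ Real.arcsin (Real.sin t) := fun h => hne <| by
    rw [← Real.sin_arcsin (Real.neg_one_le_sin τ) (Real.sin_le_one τ), h,
      Real.sin_arcsin (Real.neg_one_le_sin t) (Real.sin_le_one t)]
  generalize Real.arcsin (Real.sin t) = t at *
  generalize Real.arcsin (Real.sin τ) = τ at *
  by_cases hφ : |p * Real.sin τ - p * Real.sin t| ≤ Real.pi
  · exact contactFun_pos_of_abs_le hp ht hτ hne' hφ
  · rcases lt_abs.1 (not_le.1 hφ) with h | h
    · rw [← contactFun_neg]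
      refine contactFun_pos_of_lt_neg_pi hp hpπ ⟨by linarith [ht.2], by linarith [ht.1]⟩ ?_
      simp only [Real.sin_neg]
      linarith
    · exact contactFun_pos_of_lt_neg_pi hp hpπ ht (by linarith)

theorem contactFun_eq_zero {p τ t : ℝ} (h : Real.sin τ = Real.sin t) : contactFun p τ t = 0 := by
  have hc : |Real.cos τ| = |Real.cos t| := by
    rw [Real.abs_cos_eq_sqrt_one_sub_sin_sq, Real.abs_cos_eq_sqrt_one_sub_sin_sq, h]
  have hcosh : Real.cosh (p * Real.cos τ) = Real.cosh (p * Real.cos t) := by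
    rw [← Real.cosh_abs, ← Real.cosh_abs (p * Real.cos t), abs_mul, hc, abs_mul]
  rw [contactFun, h, hcosh]
  simp

/-! ### The boundary curve and its pencil of tangent disks -/

/-- The point of argument `t` of the circle of radius `p`, exponentiated. -/
noncomputable def boundaryPoint (p t : ℝ) : ℂ :=
  Complex.exp ((p : ℂ) * ((Real.cos t : ℂ) + Complex.I * (Real.sin t : ℂ)))

/-- The outer unit normal vector of `exp (closedBall 0 p)` in `boundaryPoint p t`. -/
noncomputable def outerNormal (p t : ℝ) : ℂ :=
  Complex.exp ((t + p * Real.sin t : ℝ) * Complex.I)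

theorem norm_outerNormal (p t : ℝ) : ‖outerNormal p t‖ = 1 :=
  Complex.norm_exp_ofReal_mul_I _

theorem boundaryPoint_eq (p t : ℝ) : boundaryPoint p t =
    Real.exp (p * Real.cos t) * Complex.exp ((p * Real.sin t : ℝ) * Complex.I) := by
  rw [boundaryPoint, Complex.ofReal_exp, ← Complex.exp_add]
  congr 1
  push_cast
  ring

theorem outerNormal_eq (p t : ℝ) : outerNormal p t =
    (Real.cos t + Real.sin t * Complex.I) * Complex.exp ((p * Real.sin t : ℝ) * Complex.I) := by
  rw [outerNormal, Complex.ofReal_add, add_mul, Complex.exp_add, Complex.exp_mul_I (t : ℂ)]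
  simp

theorem exp_eq_cosh_add_mul_sinhQuot (q x : ℝ) :
    Real.exp (q * x) = Real.cosh (q * x) + x * sinhQuot q x := by
  rw [mul_sinhQuot, Real.cosh_add_sinh]

/-- Moving from the center along the normal by the radius adds the term `cos t * sinhQuot p₂ (cos
t)` to `cosh (p₂ cos t)`, completing it to an exponential, and cancels the `sin t` term. -/
theorem normalCenter_eq (p₁ p₂ t : ℝ) : normalCenter p₁ p₂ t =
    boundaryPoint (p₁ + p₂) t - normalRadius p₁ p₂ t * outerNormal (p₁ + p₂) t := by
  rw [normalCenter, boundaryPoint_eq, outerNormal_eq, normalRadius, add_mul p₁ p₂ (Real.cos t),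
    Real.exp_add, exp_eq_cosh_add_mul_sinhQuot p₂]
  push_cast
  ring

theorem normalRadius_nonneg {p₂ : ℝ} (h : 0 ≤ p₂) (p₁ t : ℝ) : 0 ≤ normalRadius p₁ p₂ t := by
  rcases h.eq_or_lt with rfl | h
  · simp [normalRadius, sinhQuot]
  · exact (mul_pos (Real.exp_pos _) (sinhQuot_pos h _)).le

theorem normalRadius_pos {p₂ : ℝ} (h : 0 < p₂) (p₁ t : ℝ) : 0 < normalRadius p₁ p₂ t :=
  mul_pos (Real.exp_pos _) (sinhQuot_pos h _)

theorem normalRadius_zero_right (p₁ t : ℝ) : normalRadius p₁ 0 t = 0 := by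
  simp [normalRadius, sinhQuot]

theorem normalRadius_zero_left (p t : ℝ) : normalRadius 0 p t = sinhQuot p (Real.cos t) := by
  simp [normalRadius]

theorem hasDerivAt_normalRadius (p q t : ℝ) :
    HasDerivAt (fun q => normalRadius (p - q) q t)
      (Real.exp ((p - q) * Real.cos t) * Real.exp (-(q * Real.cos t))) q := by
  have h1 : HasDerivAt (fun q => sinhQuot q (Real.cos t)) (Real.cosh (q * Real.cos t)) q := by
    simpa using hasDerivAt_sinhQuot 1 (Real.cos t) q
  have h2 : HasDerivAt (fun q : ℝ => (p - q) * Real.cos t) (-Real.cos t) q := by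
    simpa using ((hasDerivAt_id q).const_sub p).mul_const (Real.cos t)
  refine (h2.exp.fun_mul h1).congr_deriv ?_
  rw [← Real.cosh_sub_sinh, ← mul_sinhQuot]
  ring

/-- The derivative is `exp ((p - 2q) cos t)`. -/
theorem strictMono_normalRadius (p t : ℝ) : StrictMono fun q => normalRadius (p - q) q t :=
  strictMono_of_deriv_pos fun q => by
    rw [(hasDerivAt_normalRadius p q t).deriv]
    positivity

theorem exists_normalRadius_eq {p t r : ℝ} (hp : 0 ≤ p) (hr : 0 ≤ r)
    (hrp : r ≤ normalRadius 0 p t) : ∃ q ∈ Set.Icc 0 p, normalRadius (p - q) q t = r := by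
  have hc : Continuous fun q => normalRadius (p - q) q t :=
    continuous_iff_continuousAt.2 fun q => (hasDerivAt_normalRadius p q t).continuousAt
  exact intermediate_value_Icc hp hc.continuousOn
    ⟨by simpa [normalRadius_zero_right] using hr, by simpa using hrp⟩

/-! ### The largest tangent disk lies in the exponential of the closed disk -/

theorem norm_exp_sub_normalCenter_sq (p t x y : ℝ) :
    ‖(Real.exp x : ℂ) * Complex.exp (y * Complex.I) - normalCenter 0 p t‖ ^ 2 =
      normalRadius 0 p t ^ 2 + 2 * Real.exp x * (Real.cosh x
        - Real.cosh (p * Real.cos t) * Real.cos (y - p * Real.sin t)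
        + Real.sin t * sinhQuot p (Real.cos t) * Real.sin (y - p * Real.sin t)) := by
  have hy : Complex.exp (y * Complex.I) = Complex.exp ((p * Real.sin t : ℝ) * Complex.I) *
      Complex.exp ((y - p * Real.sin t : ℝ) * Complex.I) := by
    rw [← Complex.exp_add]
    congr 1
    push_cast
    ring
  have hfac : (Real.exp x : ℂ) * Complex.exp (y * Complex.I) - normalCenter 0 p t =
      Complex.exp ((p * Real.sin t : ℝ) * Complex.I) *
        ((Real.exp x : ℂ) * Complex.exp ((y - p * Real.sin t : ℝ) * Complex.I) -
          (Real.cosh (p * Real.cos t) -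
            (sinhQuot p (Real.cos t) * Real.sin t : ℝ) * Complex.I)) := by
    rw [hy, normalCenter]
    simp
    ring
  rw [hfac, norm_mul, Complex.norm_exp_ofReal_mul_I, one_mul, ← Complex.normSq_eq_norm_sq,
    Complex.normSq_apply, normalRadius_zero_left]
  generalize y - p * Real.sin t = φ
  simp only [Complex.sub_re, Complex.sub_im, Complex.mul_re, Complex.mul_im, Complex.ofReal_re,
    Complex.ofReal_im, Complex.I_re, Complex.I_im, Complex.exp_ofReal_mul_I_re,
    Complex.exp_ofReal_mul_I_im]
  have h1 := mul_sinhQuot p (Real.cos t)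
  have h2 := Real.cosh_sq (p * Real.cos t)
  rw [← h1] at h2
  have h3 := Real.sin_sq_add_cos_sq t
  have h4 := Real.sin_sq_add_cos_sq φ
  have h5 : Real.exp x * Real.cosh x * 2 = Real.exp x ^ 2 + 1 := by
    rw [Real.cosh_eq, Real.exp_neg]
    field_simp
  linear_combination h2 + sinhQuot p (Real.cos t) ^ 2 * h3 + Real.exp x ^ 2 * h4 - h5

theorem norm_boundaryPoint_sub_normalCenter_sq (p τ t : ℝ) :
    ‖boundaryPoint p τ - normalCenter 0 p t‖ ^ 2 =
      normalRadius 0 p t ^ 2 + 2 * Real.exp (p * Real.cos τ) * contactFun p τ t := by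
  rw [boundaryPoint_eq, norm_exp_sub_normalCenter_sq, contactFun]

theorem boundaryPoint_mem_closedBall_iff {p : ℝ} (hp : 0 < p) (hpπ : p < Real.pi) (τ t : ℝ) :
    boundaryPoint p τ ∈ Metric.closedBall (normalCenter 0 p t) (normalRadius 0 p t) ↔
      Real.sin τ = Real.sin t := by
  have hr := normalRadius_nonneg hp.le 0 t
  rw [Metric.mem_closedBall, dist_eq_norm, ← sq_le_sq₀ (norm_nonneg _) hr,
    norm_boundaryPoint_sub_normalCenter_sq]
  constructor
  · intro h
    by_contra hne
    have h1 := contactFun_pos hp hpπ hne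
    have : 0 < 2 * Real.exp (p * Real.cos τ) * contactFun p τ t := by positivity
    linarith
  · intro h
    rw [contactFun_eq_zero h]
    simp

theorem boundaryPoint_not_mem_ball {p : ℝ} (hp : 0 < p) (hpπ : p < Real.pi) (τ t : ℝ) :
    boundaryPoint p τ ∉ Metric.ball (normalCenter 0 p t) (normalRadius 0 p t) := by
  have hr := normalRadius_nonneg hp.le 0 t
  intro h
  have hs := (boundaryPoint_mem_closedBall_iff hp hpπ τ t).1 (Metric.ball_subset_closedBall h)
  rw [Metric.mem_ball, dist_eq_norm, ← sq_lt_sq₀ (norm_nonneg _) hr,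
    norm_boundaryPoint_sub_normalCenter_sq, contactFun_eq_zero hs] at h
  simp at h

theorem exists_eq_mul_of_norm_eq {w : ℂ} {p : ℝ} (h : ‖w‖ = p) :
    ∃ τ : ℝ, w = (p : ℂ) * ((Real.cos τ : ℂ) + Complex.I * (Real.sin τ : ℂ)) := by
  refine ⟨w.arg, ?_⟩
  conv_lhs => rw [← Complex.norm_mul_exp_arg_mul_I w, h, Complex.exp_mul_I]
  push_cast
  ring

theorem exists_mem_ball_normalCenter {p : ℝ} (hp : 0 < p) (hpπ : p < Real.pi) (t : ℝ) :
    ∃ w ∈ Metric.ball (0 : ℂ) p,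
      Complex.exp w ∈ Metric.ball (normalCenter 0 p t) (normalRadius 0 p t) := by
  have hr := normalRadius_nonneg hp.le 0 t
  suffices h : ∃ y : ℝ, |y| < p ∧ 1 - Real.cosh (p * Real.cos t) * Real.cos (y - p * Real.sin t)
        + Real.sin t * sinhQuot p (Real.cos t) * Real.sin (y - p * Real.sin t) < 0 by
    obtain ⟨y, hy, h⟩ := h
    refine ⟨y * Complex.I, by simpa using hy, ?_⟩
    have h1 := norm_exp_sub_normalCenter_sq p t 0 y
    rw [Metric.mem_ball, dist_eq_norm, ← sq_lt_sq₀ (norm_nonneg _) hr]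
    simp only [Real.exp_zero, Complex.ofReal_one, one_mul, Real.cosh_zero, mul_one] at h1
    rw [h1]
    linarith
  by_cases hc : Real.cos t = 0
  · have hs : Real.sin t * Real.sin t = 1 := by
      have := Real.sin_sq_add_cos_sq t
      rw [hc] at this
      linarith
    have hs1 : |Real.sin t| = 1 := by
      rw [← sq_eq_sq₀ (abs_nonneg _) zero_le_one, sq_abs]
      linarith
    -- Half way to the contact point. The claim reduces to `sin (p/4) < p cos (p/4)`, which holds
    -- because `p/4 < 1`.
    refine ⟨Real.sin t * (p / 2), by rw [abs_mul, hs1, one_mul, abs_of_pos] <;> linarith, ?_⟩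
    have hsin : Real.sin t * Real.sin (Real.sin t * (p / 2) - p * Real.sin t) =
        -Real.sin (p / 2) := by
      rcases (abs_eq zero_le_one).1 hs1 with h | h <;> rw [h]
      · rw [one_mul, ← Real.sin_neg]
        congr 1
        ring
      · rw [neg_one_mul]
        congr 2
        ring
    have hcos : Real.cos (Real.sin t * (p / 2) - p * Real.sin t) = Real.cos (p / 2) := by
      rcases (abs_eq zero_le_one).1 hs1 with h | h <;> rw [h]
      · rw [← Real.cos_neg]
        congr 1
        ring
      · congr 1
        ring
    rw [hc, hcos, sinhQuot, if_pos rfl, mul_zero, Real.cosh_zero, one_mul]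
    have hx : p / 2 = 2 * (p / 4) := by ring
    have hsin2 : Real.sin (p / 2) = 2 * Real.sin (p / 4) * Real.cos (p / 4) := by
      rw [hx, Real.sin_two_mul]
    have hcos2 : Real.cos (p / 2) = 1 - 2 * Real.sin (p / 4) ^ 2 := by
      rw [hx, Real.cos_two_mul, Real.cos_sq']
      ring
    have hpi := Real.pi_lt_four
    have h1 : 0 < Real.sin (p / 4) := Real.sin_pos_of_pos_of_lt_pi (by linarith) (by linarith)
    have h2 : Real.sin (p / 4) < p / 4 := Real.sin_lt (by linarith)
    have h3 : 1 / 2 ≤ Real.cos (p / 4) := by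
      have := Real.one_sub_sq_div_two_le_cos (x := p / 4)
      nlinarith
    have h4 : Real.sin (p / 4) < p * Real.cos (p / 4) := by nlinarith
    have h5 := mul_lt_mul_of_pos_left h4 h1
    rw [hcos2]
    linear_combination p * hsin - p * hsin2 + 2 * h5
  -- The point of the imaginary axis with the same imaginary part as the two contact points: the
  -- claim is `1 < cosh (p cos t)`.
  · refine ⟨p * Real.sin t, ?_, ?_⟩
    · have h1 : |Real.sin t| < 1 := by
        rw [← sq_lt_one_iff_abs_lt_one, Real.sin_sq]
        have : 0 < Real.cos t ^ 2 := by positivity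
        linarith
      rw [abs_mul, abs_of_pos hp]
      nlinarith
    · have := Real.one_lt_cosh.2 (mul_ne_zero hp.ne' hc)
      simpa using this

/-- The ball is connected, avoids the image of the circle and meets the open set `exp (D(0, p))`. So
it cannot reach the complement of the compact set `exp (D̄(0, p))`. -/
theorem ball_normalCenter_subset {p : ℝ} (hp : 0 < p) (hpπ : p < Real.pi) (t : ℝ) :
    Metric.ball (normalCenter 0 p t) (normalRadius 0 p t) ⊆
      Complex.exp '' Metric.ball (0 : ℂ) p := by
  have hclosed : IsClosed (Complex.exp '' Metric.closedBall (0 : ℂ) p) :=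
    ((isCompact_closedBall 0 p).image Complex.continuous_exp).isClosed
  refine (convex_ball _ _).isPreconnected.subset_left_of_subset_union
    (Complex.isOpenMap_exp _ Metric.isOpen_ball) hclosed.isOpen_compl ?_ ?_ ?_
  · exact Set.disjoint_compl_right_iff_subset.2 (Set.image_mono Metric.ball_subset_closedBall)
  · intro z hz
    by_contra hout
    simp only [Set.mem_union, Set.mem_compl_iff, not_or, not_not] at hout
    obtain ⟨hout, w, hw, rfl⟩ := hout
    have hwp : ‖w‖ = p := by
      refine le_antisymm (by simpa using hw) (not_lt.1 fun h => hout ⟨w, by simpa using h, rfl⟩)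
    obtain ⟨τ, rfl⟩ := exists_eq_mul_of_norm_eq hwp
    exact boundaryPoint_not_mem_ball hp hpπ τ t hz
  · obtain ⟨w, hw, hw'⟩ := exists_mem_ball_normalCenter hp hpπ t
    exact ⟨_, hw', w, hw, rfl⟩

theorem closedBall_normalCenter_subset {p : ℝ} (hp : 0 < p) (hpπ : p < Real.pi) (t : ℝ) :
    Metric.closedBall (normalCenter 0 p t) (normalRadius 0 p t) ⊆
      Complex.exp '' Metric.closedBall (0 : ℂ) p := by
  rw [← closure_ball _ (normalRadius_pos hp 0 t).ne']
  exact closure_minimal ((ball_normalCenter_subset hp hpπ t).trans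
    (Set.image_mono Metric.ball_subset_closedBall))
    ((isCompact_closedBall 0 p).image Complex.continuous_exp).isClosed

/-! ### Disks that touch the boundary from inside -/

/-- The exponential is injective on `|Im| < π`, which contains both disks. -/
theorem le_of_boundaryPoint_mem {q r τ : ℝ} (hq : 0 ≤ q) (hqπ : q < Real.pi) (hr : r < Real.pi)
    (h : boundaryPoint q τ ∈ Complex.exp '' Metric.closedBall (0 : ℂ) r) : q ≤ r := by
  obtain ⟨w, hw, hwe⟩ := h
  rw [mem_closedBall_zero_iff] at hw
  have hwi := abs_lt.1 (((Complex.abs_im_le_norm w).trans hw).trans_lt hr)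
  set v : ℂ := (q : ℂ) * ((Real.cos τ : ℂ) + Complex.I * (Real.sin τ : ℂ)) with hv
  have hvn : ‖v‖ = q := by
    have : v = q * Complex.exp (τ * Complex.I) := by
      rw [hv, Complex.exp_mul_I]
      push_cast
      ring
    rw [this, norm_mul, Complex.norm_exp_ofReal_mul_I, mul_one, Complex.norm_real, Real.norm_eq_abs,
      abs_of_nonneg hq]
  have hvi := abs_lt.1 ((Complex.abs_im_le_norm v).trans_lt (hvn ▸ hqπ))
  have : w = v := Complex.exp_inj_of_neg_pi_lt_of_le_pi hwi.1 hwi.2.le hvi.1 hvi.2.le hwe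
  rw [← hvn, ← this]
  exact hw

/-- Of two internally tangent circles, the smaller lies strictly inside the larger except at the
contact point `γ`. -/
theorem mem_ball_of_mem_closedBall_of_lt {γ n z : ℂ} {r R : ℝ} (hn : ‖n‖ = 1) (hr : 0 ≤ r)
    (hrR : r < R) (hz : z ∈ Metric.closedBall (γ - r * n) r) (hne : z ≠ γ) :
    z ∈ Metric.ball (γ - R * n) R := by
  have hexp (s : ℝ) : ‖z - (γ - s * n)‖ ^ 2 =
      ‖z - γ‖ ^ 2 + 2 * s * ((z - γ) * (starRingEnd ℂ) n).re + s ^ 2 := by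
    have hn2 : n.re * n.re + n.im * n.im = 1 := by
      rw [← Complex.normSq_apply, Complex.normSq_eq_norm_sq, hn, one_pow]
    rw [← Complex.normSq_eq_norm_sq, ← Complex.normSq_eq_norm_sq, Complex.normSq_apply,
      Complex.normSq_apply]
    simp only [Complex.sub_re, Complex.sub_im, Complex.mul_re, Complex.mul_im, Complex.ofReal_re,
      Complex.ofReal_im, Complex.conj_re, Complex.conj_im]
    linear_combination s ^ 2 * hn2
  rw [Metric.mem_closedBall, dist_eq_norm, ← sq_le_sq₀ (norm_nonneg _) hr, hexp] at hz
  rw [Metric.mem_ball, dist_eq_norm, ← sq_lt_sq₀ (norm_nonneg _) (hr.trans hrR.le), hexp]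
  have hpos : 0 < ‖z - γ‖ ^ 2 := by
    have := norm_pos_iff.2 (sub_ne_zero.2 hne)
    positivity
  have hneg : ((z - γ) * (starRingEnd ℂ) n).re < 0 := by
    by_contra h
    nlinarith [mul_nonneg hr (not_lt.1 h)]
  nlinarith

theorem boundaryPoint_pi_sub_ne {p t : ℝ} (hp : 0 < p) (ht : Real.cos t ≠ 0) :
    boundaryPoint p (Real.pi - t) ≠ boundaryPoint p t := by
  intro h
  have h1 := congrArg norm h
  simp only [boundaryPoint_eq, norm_mul, Complex.norm_exp_ofReal_mul_I, Complex.norm_real,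
    Real.norm_eq_abs, Real.abs_exp, mul_one, Real.exp_eq_exp, Real.cos_pi_sub] at h1
  have := mul_left_cancel₀ hp.ne' h1
  exact ht (by linarith)

theorem hasDerivAt_boundaryPoint_right (p t : ℝ) :
    HasDerivAt (boundaryPoint p) (p * Real.exp (p * Real.cos t) * (Complex.I * outerNormal p t))
      t := by
  have h := ((((Real.hasDerivAt_cos t).ofReal_comp).add
    (((Real.hasDerivAt_sin t).ofReal_comp).const_mul Complex.I)).const_mul (p : ℂ)).cexp
  refine h.congr_deriv ?_
  change boundaryPoint p t * _ = _
  rw [boundaryPoint_eq, outerNormal_eq]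
  push_cast
  linear_combination (-Complex.exp (p * Complex.cos t) *
    Complex.exp (p * Complex.sin t * Complex.I) * p * Complex.sin t) * Complex.I_mul_I

theorem hasDerivAt_boundaryPoint_left (p t : ℝ) :
    HasDerivAt (fun q => boundaryPoint q t) (Real.exp (p * Real.cos t) * outerNormal p t) p := by
  have h := (((hasDerivAt_id p).ofReal_comp).mul_const
    ((Real.cos t : ℂ) + Complex.I * (Real.sin t : ℂ))).cexp
  refine h.congr_deriv ?_
  change boundaryPoint p t * _ = _
  rw [boundaryPoint_eq, outerNormal_eq]
  push_cast
  ring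

theorem deriv_nonneg_of_le_right {f : ℝ → ℝ} {f' a b : ℝ} (hf : HasDerivAt f f' a) (hab : a < b)
    (h : ∀ x ∈ Set.Ioo a b, f a ≤ f x) : 0 ≤ f' := by
  have h1 := (hasDerivWithinAt_iff_tendsto_slope' (Set.self_notMem_Ioi (a := a))).1
    (hf.hasDerivWithinAt (s := Set.Ioi a))
  refine ge_of_tendsto h1 ?_
  filter_upwards [Ioo_mem_nhdsGT hab] with x hx
  rw [slope_def_field]
  exact div_nonneg (sub_nonneg.2 (h x hx)) (sub_nonneg.2 hx.1.le)

/-- A point in the open disk could be pushed slightly outwards, to radius `> p`, without leaving it.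
-/
theorem le_norm_boundaryPoint_sub_of_subset {p r τ : ℝ} {z : ℂ} (hp : 0 ≤ p) (hpπ : p < Real.pi)
    (hsub : Metric.closedBall z r ⊆ Complex.exp '' Metric.closedBall (0 : ℂ) p) {q : ℝ}
    (hpq : p ≤ q) (hq : q < Real.pi) : r ≤ ‖boundaryPoint q τ - z‖ := by
  by_contra hlt
  have hcont : Filter.Tendsto (fun q => boundaryPoint q τ) (nhdsWithin q (Set.Ioi q))
      (nhds (boundaryPoint q τ)) :=
    (hasDerivAt_boundaryPoint_left q τ).continuousAt.tendsto.mono_left nhdsWithin_le_nhds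
  have hmem : boundaryPoint q τ ∈ Metric.ball z r := by
    rw [Metric.mem_ball, dist_eq_norm]
    exact not_le.1 hlt
  have h1 := hcont.eventually (Metric.isOpen_ball.mem_nhds hmem)
  obtain ⟨q', hq', hq'I⟩ := (h1.and (Ioo_mem_nhdsGT hq)).exists
  have := le_of_boundaryPoint_mem (by linarith [hq'I.1]) hq'I.2 hpπ
    (hsub (Metric.ball_subset_closedBall hq'))
  linarith [hq'I.1]

/-- A disk in `exp (closedBall 0 p)` containing `boundaryPoint p t` touches the boundary there. -/
theorem center_eq_of_subset {p r t : ℝ} {z : ℂ} (hp : 0 < p) (hpπ : p < Real.pi)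
    (hsub : Metric.closedBall z r ⊆ Complex.exp '' Metric.closedBall (0 : ℂ) p)
    (hmem : boundaryPoint p t ∈ Metric.closedBall z r) :
    z = boundaryPoint p t - r * outerNormal p t := by
  have hle (q τ : ℝ) (hpq : p ≤ q) (hq : q < Real.pi) :=
    le_norm_boundaryPoint_sub_of_subset (τ := τ) hp.le hpπ hsub hpq hq
  have hr : ‖boundaryPoint p t - z‖ = r :=
    le_antisymm (by simpa [dist_eq_norm] using hmem) (hle p t le_rfl hpπ)
  have hr0 : 0 ≤ r := hr ▸ norm_nonneg _
  have hd1 := ((hasDerivAt_boundaryPoint_right p t).sub_const z).norm_sq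
  have hd2 := ((hasDerivAt_boundaryPoint_left p t).sub_const z).norm_sq
  -- Among the points of radius at least `p`, the contact point is closest to `z`. Varying the angle
  -- shows that `w` is normal to the curve, varying the radius that it does not point inwards.
  have hz1 := IsLocalMin.hasDerivAt_eq_zero (Filter.Eventually.of_forall fun τ => by
    have := hle p τ le_rfl hpπ
    rw [← hr] at this
    exact pow_le_pow_left₀ (norm_nonneg _) this 2) hd1
  have hz2 := deriv_nonneg_of_le_right hd2 hpπ fun q hq => by
    have := hle q t hq.1.le hq.2
    rw [← hr] at this
    exact pow_le_pow_left₀ (norm_nonneg _) this 2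
  set w := boundaryPoint p t - z with hw
  set n := outerNormal p t with hn
  have hE := Real.exp_pos (p * Real.cos t)
  have hn2 : n.re * n.re + n.im * n.im = 1 := by
    rw [← Complex.normSq_apply, Complex.normSq_eq_norm_sq, norm_outerNormal, one_pow]
  have hw2 : w.re * w.re + w.im * w.im = r ^ 2 := by
    rw [← Complex.normSq_apply, Complex.normSq_eq_norm_sq, hr]
  have h1 : w.im * n.re - w.re * n.im = 0 := by
    have h : 2 * (p * Real.exp (p * Real.cos t)) * (w.im * n.re - w.re * n.im) = 0 := by
      rw [← hz1, Complex.inner]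
      simp [-Complex.ofReal_exp]
      ring
    have : 2 * (p * Real.exp (p * Real.cos t)) ≠ 0 := by positivity
    exact (mul_eq_zero.1 h).resolve_left this
  have h2 : 0 ≤ w.re * n.re + w.im * n.im := by
    have h : 0 ≤ 2 * Real.exp (p * Real.cos t) * (w.re * n.re + w.im * n.im) := by
      refine hz2.trans_eq ?_
      rw [Complex.inner]
      simp [-Complex.ofReal_exp]
      ring
    exact nonneg_of_mul_nonneg_right h (by positivity)
  have h3 : w.re * n.re + w.im * n.im = r := by
    rw [← sq_eq_sq₀ h2 hr0]
    linear_combination hn2 * r ^ 2 + (n.re * n.re + n.im * n.im) * hw2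
      - h1 * (w.im * n.re - w.re * n.im)
  have h4 : w = r * n := by
    apply Complex.ext
    · simp
      linear_combination (-w.re) * hn2 + n.re * h3 - n.im * h1
    · simp
      linear_combination (-w.im) * hn2 + n.im * h3 + n.re * h1
  rw [← h4, hw]
  ring

/-- The curvature bound where the contact points merge. The expression vanishes at `ε = 0` and has
derivative `sin ε * B ε` with `B 0 = p (p - r) < 0`. -/
theorem exists_cosh_sub_neg {p r : ℝ} (hp : 0 < p) (hpr : p < r) :
    ∃ ε : ℝ, Real.cosh (p * Real.sin ε) - Real.cos (p * Real.cos ε - p)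
      + r * Real.sin (p * Real.cos ε - p) < 0 := by
  set G : ℝ → ℝ := fun ε => Real.cosh (p * Real.sin ε) - Real.cos (p * Real.cos ε - p)
      + r * Real.sin (p * Real.cos ε - p) with hG
  set B : ℝ → ℝ := fun ε => p * Real.cos ε * sinhQuot p (Real.sin ε)
    - p * Real.sin (p * Real.cos ε - p) - r * p * Real.cos (p * Real.cos ε - p) with hB
  have hderiv (ε : ℝ) : HasDerivAt G (Real.sin ε * B ε) ε := by
    have h1 := ((Real.hasDerivAt_sin ε).const_mul p).cosh
    have h2 := ((Real.hasDerivAt_cos ε).const_mul p).sub_const p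
    refine ((h1.sub h2.cos).add (h2.sin.const_mul r)).congr_deriv ?_
    rw [← mul_sinhQuot]
    simp only [hB]
    ring
  have hBc : Continuous B := by
    have := continuous_sinhQuot p
    fun_prop
  have hB0 : B 0 < 0 := by
    simp [hB, sinhQuot]
    nlinarith
  obtain ⟨δ, hδ, hBδ⟩ := Metric.eventually_nhds_iff.1
    (hBc.continuousAt.eventually_lt continuousAt_const hB0)
  set η := min (δ / 2) (Real.pi / 2) with hη
  have hη0 : 0 < η := by
    have := Real.pi_pos
    positivity
  have hanti : StrictAntiOn G (Set.Icc 0 η) := by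
    refine strictAntiOn_of_deriv_neg (convex_Icc 0 η)
      (fun ε _ => (hderiv ε).continuousAt.continuousWithinAt) fun ε hε => ?_
    rw [interior_Icc] at hε
    rw [(hderiv ε).deriv]
    refine mul_neg_of_pos_of_neg (Real.sin_pos_of_pos_of_lt_pi hε.1 ?_) (hBδ ?_)
    · linarith [min_le_right (δ / 2) (Real.pi / 2), hε.2, Real.pi_pos]
    · rw [Real.dist_eq, sub_zero, abs_of_pos hε.1]
      linarith [min_le_left (δ / 2) (Real.pi / 2), hε.2]
  refine ⟨η, (hanti (Set.left_mem_Icc.2 hη0.le) (Set.right_mem_Icc.2 hη0.le) hη0).trans_eq ?_⟩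
  simp [hG]

theorem norm_boundaryPoint_sub_sq {p τ t : ℝ} (ht : Real.cos t = 0) (r : ℝ) :
    ‖boundaryPoint p τ - (boundaryPoint p t - r * outerNormal p t)‖ ^ 2 = r ^ 2
      + 2 * Real.exp (p * Real.cos τ) * (Real.cosh (p * Real.cos τ)
        - Real.cos (p * Real.sin τ - p * Real.sin t)
        + r * (Real.sin t * Real.sin (p * Real.sin τ - p * Real.sin t))) := by
  have hs : Real.sin t ^ 2 = 1 := by
    have := Real.sin_sq_add_cos_sq t
    rw [ht] at this
    linarith
  have hy : Complex.exp ((p * Real.sin τ : ℝ) * Complex.I) =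
      Complex.exp ((p * Real.sin t : ℝ) * Complex.I) *
      Complex.exp ((p * Real.sin τ - p * Real.sin t : ℝ) * Complex.I) := by
    rw [← Complex.exp_add]
    congr 1
    push_cast
    ring
  have hfac : boundaryPoint p τ - (boundaryPoint p t - r * outerNormal p t) =
      Complex.exp ((p * Real.sin t : ℝ) * Complex.I) *
        ((Real.exp (p * Real.cos τ) : ℝ) *
          Complex.exp ((p * Real.sin τ - p * Real.sin t : ℝ) * Complex.I)
          - (1 - (r * Real.sin t : ℝ) * Complex.I)) := by
    rw [boundaryPoint_eq p τ, hy, boundaryPoint_eq, outerNormal_eq, ht]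
    simp
    ring
  rw [hfac, norm_mul, Complex.norm_exp_ofReal_mul_I, one_mul, ← Complex.normSq_eq_norm_sq,
    Complex.normSq_apply]
  generalize p * Real.sin τ - p * Real.sin t = φ
  simp only [Complex.sub_re, Complex.sub_im, Complex.mul_re, Complex.mul_im, Complex.ofReal_re,
    Complex.ofReal_im, Complex.I_re, Complex.I_im, Complex.exp_ofReal_mul_I_re,
    Complex.exp_ofReal_mul_I_im, Complex.one_re, Complex.one_im]
  have h4 := Real.sin_sq_add_cos_sq φ
  generalize p * Real.cos τ = x
  have h5 : Real.exp x * Real.cosh x * 2 = Real.exp x ^ 2 + 1 := by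
    rw [Real.cosh_eq, Real.exp_neg]
    field_simp
  linear_combination Real.exp x ^ 2 * h4 - h5 + r ^ 2 * hs

theorem radius_le_of_subset {p r t : ℝ} {z : ℂ} (hp : 0 < p) (hpπ : p < Real.pi)
    (hsub : Metric.closedBall z r ⊆ Complex.exp '' Metric.closedBall (0 : ℂ) p)
    (hmem : boundaryPoint p t ∈ Metric.closedBall z r) : r ≤ normalRadius 0 p t := by
  have hz := center_eq_of_subset hp hpπ hsub hmem
  have hr0 : 0 ≤ r := dist_nonneg.trans hmem
  have hle (τ : ℝ) := le_norm_boundaryPoint_sub_of_subset (τ := τ) hp.le hpπ hsub le_rfl hpπ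
  rw [hz] at hle
  by_contra hlt
  rw [not_le] at hlt
  by_cases hc : Real.cos t = 0
  · rw [normalRadius_zero_left, hc, sinhQuot, if_pos rfl] at hlt
    have hs : Real.sin t = 1 ∨ Real.sin t = -1 := Real.cos_eq_zero_iff_sin_eq.1 hc
    obtain ⟨ε, hε⟩ := exists_cosh_sub_neg hp hlt
    obtain ⟨τ, hτc, hτs⟩ : ∃ τ, Real.cos τ = Real.sin ε ∧ Real.sin τ = Real.sin t * Real.cos ε := by
      rcases hs with h | h
      · exact ⟨Real.pi / 2 - ε, Real.cos_pi_div_two_sub ε, by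
          rw [Real.sin_pi_div_two_sub, h, one_mul]⟩
      · refine ⟨ε - Real.pi / 2, Real.cos_sub_pi_div_two ε, ?_⟩
        rw [Real.sin_sub_pi_div_two, h, neg_one_mul]
    have h1 := pow_le_pow_left₀ hr0 (hle τ) 2
    rw [norm_boundaryPoint_sub_sq hc, hτc, hτs] at h1
    have h2 : Real.cos (p * (Real.sin t * Real.cos ε) - p * Real.sin t) =
        Real.cos (p * Real.cos ε - p) := by
      rcases hs with h | h <;> rw [h]
      · simp
      · rw [← Real.cos_neg]
        congr 1
        ring
    have h3 : Real.sin t * Real.sin (p * (Real.sin t * Real.cos ε) - p * Real.sin t) =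
        Real.sin (p * Real.cos ε - p) := by
      rcases hs with h | h <;> rw [h]
      · simp
      · rw [neg_one_mul, ← Real.sin_neg]
        congr 1
        ring
    rw [h2, h3] at h1
    have := mul_neg_of_pos_of_neg (mul_pos two_pos (Real.exp_pos (p * Real.sin ε))) hε
    linarith
  · have h1 : boundaryPoint p (Real.pi - t) ∈
        Metric.closedBall (normalCenter 0 p t) (normalRadius 0 p t) := by
      rw [boundaryPoint_mem_closedBall_iff hp hpπ, Real.sin_pi_sub]
    rw [normalCenter_eq, zero_add] at h1
    have h2 := mem_ball_of_mem_closedBall_of_lt (norm_outerNormal p t)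
      (normalRadius_nonneg hp.le 0 t) hlt h1 (boundaryPoint_pi_sub_ne hp hc)
    rw [Metric.mem_ball, dist_eq_norm] at h2
    exact absurd (hle (Real.pi - t)) (not_le.2 h2)

/-! ### Existence and uniqueness of the disk parameters -/

theorem normalRadius_le {p₁ : ℝ} (h₁ : 0 ≤ p₁) (p₂ t : ℝ) :
    normalRadius p₁ p₂ t ≤ normalRadius 0 (p₁ + p₂) t := by
  have := (strictMono_normalRadius (p₁ + p₂) t).monotone (show p₂ ≤ p₁ + p₂ by linarith)
  simpa using this

theorem closedBall_subset_of_tangent {γ n : ℂ} {r R : ℝ} (hn : ‖n‖ = 1) (hrR : r ≤ R) :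
    Metric.closedBall (γ - r * n) r ⊆ Metric.closedBall (γ - R * n) R := by
  refine Metric.closedBall_subset_closedBall' ?_
  have : γ - r * n - (γ - R * n) = ((R - r : ℝ) : ℂ) * n := by
    push_cast
    ring
  rw [dist_eq_norm, this, norm_mul, hn, Complex.norm_real, Real.norm_eq_abs,
    abs_of_nonneg (sub_nonneg.2 hrR)]
  linarith

theorem le_of_closedBall_subset_of_tangent {γ n : ℂ} {r R : ℝ} (hn : ‖n‖ = 1) (hrR : r ≤ R)
    (hR : 0 ≤ R)
    (h : Metric.closedBall (γ - R * n) R ⊆ Metric.closedBall (γ - r * n) r) : r = R := by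
  -- The point of the larger circle opposite to the contact point.
  have hmem : γ - (2 * R : ℝ) * n ∈ Metric.closedBall (γ - R * n) R := by
    have : γ - (2 * R : ℝ) * n - (γ - R * n) = ((-R : ℝ) : ℂ) * n := by
      push_cast
      ring
    rw [Metric.mem_closedBall, dist_eq_norm, this, norm_mul, hn, Complex.norm_real,
      Real.norm_eq_abs, abs_neg, abs_of_nonneg hR, mul_one]
  have h1 := h hmem
  have : γ - (2 * R : ℝ) * n - (γ - r * n) = ((r - 2 * R : ℝ) : ℂ) * n := by
    push_cast
    ring
  rw [Metric.mem_closedBall, dist_eq_norm, this, norm_mul, hn, Complex.norm_real,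
    Real.norm_eq_abs, mul_one] at h1
  linarith [neg_abs_le (r - 2 * R)]

theorem boundaryPoint_mem_normalDisk {p₂ : ℝ} (h₂ : 0 ≤ p₂) (p₁ t : ℝ) :
    boundaryPoint (p₁ + p₂) t ∈
      Metric.closedBall (normalCenter p₁ p₂ t) (normalRadius p₁ p₂ t) := by
  rw [Metric.mem_closedBall, dist_eq_norm, normalCenter_eq, sub_sub_cancel, norm_mul,
    norm_outerNormal, mul_one, Complex.norm_real, Real.norm_eq_abs,
    abs_of_nonneg (normalRadius_nonneg h₂ p₁ t)]

theorem normalDisk_subset_maximal {p₁ : ℝ} (h₁ : 0 ≤ p₁) (p₂ t : ℝ) :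
    Metric.closedBall (normalCenter p₁ p₂ t) (normalRadius p₁ p₂ t) ⊆
      Metric.closedBall (normalCenter 0 (p₁ + p₂) t) (normalRadius 0 (p₁ + p₂) t) := by
  rw [normalCenter_eq, normalCenter_eq, zero_add]
  exact closedBall_subset_of_tangent (norm_outerNormal _ _) (normalRadius_le h₁ p₂ t)

theorem normalDisk_subset {p₁ p₂ : ℝ} (h₁ : 0 ≤ p₁) (h₂ : 0 ≤ p₂) (hπ : p₁ + p₂ < Real.pi)
    (t : ℝ) : Metric.closedBall (normalCenter p₁ p₂ t) (normalRadius p₁ p₂ t) ⊆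
      Complex.exp '' Metric.closedBall (0 : ℂ) (p₁ + p₂) := by
  rcases (add_nonneg h₁ h₂).eq_or_lt with h | h
  · obtain rfl : p₁ = 0 := by linarith
    obtain rfl : p₂ = 0 := by linarith
    simp [normalCenter, normalRadius, sinhQuot]
  · exact (normalDisk_subset_maximal h₁ p₂ t).trans (closedBall_normalCenter_subset h hπ t)

theorem cos_eq_of_boundaryPoint_eq {p τ t : ℝ} (hp : p ≠ 0)
    (h : boundaryPoint p τ = boundaryPoint p t) : Real.cos τ = Real.cos t := by
  have h1 := congrArg norm h
  simp only [boundaryPoint_eq, norm_mul, Complex.norm_exp_ofReal_mul_I, Complex.norm_real,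
    Real.norm_eq_abs, Real.abs_exp, mul_one, Real.exp_eq_exp] at h1
  exact mul_left_cancel₀ hp h1

/-- If `p₁ > 0`, the disk is smaller than the largest one, so apart from `γ(t)` it lies in an open
ball free of boundary points. -/
theorem sin_eq_and_cos_eq_of_boundaryPoint_mem {p₁ p₂ τ t : ℝ} (h₁ : 0 ≤ p₁) (h₂ : 0 ≤ p₂)
    (h0 : 0 < p₁ + p₂) (hπ : p₁ + p₂ < Real.pi)
    (h : boundaryPoint (p₁ + p₂) τ ∈
      Metric.closedBall (normalCenter p₁ p₂ t) (normalRadius p₁ p₂ t)) :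
    Real.sin τ = Real.sin t ∧ (0 < p₁ → Real.cos τ = Real.cos t) := by
  refine ⟨(boundaryPoint_mem_closedBall_iff h0 hπ τ t).1 (normalDisk_subset_maximal h₁ p₂ t h),
    fun hp => cos_eq_of_boundaryPoint_eq h0.ne' ?_⟩
  by_contra hne
  have hlt : normalRadius p₁ p₂ t < normalRadius 0 (p₁ + p₂) t := by
    have := strictMono_normalRadius (p₁ + p₂) t (show p₂ < p₁ + p₂ by linarith)
    simpa using this
  rw [normalCenter_eq] at h
  have h3 := mem_ball_of_mem_closedBall_of_lt (norm_outerNormal _ _)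
    (normalRadius_nonneg h₂ p₁ t) hlt h hne
  rw [show boundaryPoint (p₁ + p₂) t - normalRadius 0 (p₁ + p₂) t * outerNormal (p₁ + p₂) t =
    normalCenter 0 (p₁ + p₂) t by rw [normalCenter_eq, zero_add]] at h3
  exact boundaryPoint_not_mem_ball h0 hπ τ t h3

/-- Each disk contains a boundary point for its own sum of parameters, so mutual inclusion makes the
sums equal. The contact points then determine `t`, and strict monotonicity of the radius determines
`p₂`. -/
theorem normalParameters_unique {p₁ p₂ t p₁' p₂' t' : ℝ} (h₁ : 0 ≤ p₁) (h₂ : 0 ≤ p₂)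
    (h0 : 0 < p₁ + p₂) (hπ : p₁ + p₂ < Real.pi) (h₁' : 0 ≤ p₁') (h₂' : 0 ≤ p₂')
    (hπ' : p₁' + p₂' < Real.pi) (hc : normalCenter p₁ p₂ t = normalCenter p₁' p₂' t')
    (hr : normalRadius p₁ p₂ t = normalRadius p₁' p₂' t') :
    p₁' = p₁ ∧ p₂' = p₂ ∧ Real.sin t' = Real.sin t ∧ (0 < p₁ → Real.cos t' = Real.cos t) := by
  have hm := boundaryPoint_mem_normalDisk h₂ p₁ t
  have hm' := boundaryPoint_mem_normalDisk h₂' p₁' t'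
  have hsum : p₁' + p₂' = p₁ + p₂ := by
    apply le_antisymm
    · refine le_of_boundaryPoint_mem (add_nonneg h₁' h₂') hπ' hπ
        (normalDisk_subset h₁ h₂ hπ t ?_) (τ := t')
      rw [hc, hr]
      exact hm'
    · refine le_of_boundaryPoint_mem h0.le hπ hπ' (normalDisk_subset h₁' h₂' hπ' t' ?_) (τ := t)
      rw [← hc, ← hr]
      exact hm
  rw [← hc, ← hr, hsum] at hm'
  obtain ⟨hs, hcos⟩ := sin_eq_and_cos_eq_of_boundaryPoint_mem h₁ h₂ h0 hπ hm'
  have hrad : normalRadius p₁ p₂ t = normalRadius p₁ p₂ t' := by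
    rcases h₁.eq_or_lt with h | h
    · rw [← h, normalRadius_zero_left, normalRadius_zero_left, ← sinhQuot_abs,
        ← sinhQuot_abs _ (Real.cos t'), Real.abs_cos_eq_sqrt_one_sub_sin_sq,
        Real.abs_cos_eq_sqrt_one_sub_sin_sq, hs]
    · rw [normalRadius, normalRadius, hcos h]
  have hp₂ : p₂' = p₂ := (strictMono_normalRadius (p₁ + p₂) t').injective <| by
    rw [show p₁ + p₂ - p₂' = p₁' by linarith, add_sub_cancel_right, ← hr, hrad]
  exact ⟨by linarith, hp₂, hs, hcos⟩

theorem exists_normalParameters {p r t : ℝ} {z : ℂ} (hp : 0 ≤ p) (hpπ : p < Real.pi)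
    (hsub : Metric.closedBall z r ⊆ Complex.exp '' Metric.closedBall (0 : ℂ) p)
    (hmem : boundaryPoint p t ∈ Metric.closedBall z r) :
    ∃ p₁ p₂, 0 ≤ p₁ ∧ 0 ≤ p₂ ∧ p = p₁ + p₂ ∧ z = normalCenter p₁ p₂ t ∧
      r = normalRadius p₁ p₂ t := by
  have hr : 0 ≤ r := dist_nonneg.trans hmem
  rcases hp.eq_or_lt with rfl | hp
  · simp only [Metric.closedBall_zero, Set.image_singleton, Complex.exp_zero] at hsub
    have h1 : z = 1 := hsub (Metric.mem_closedBall_self hr)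
    have h2 : z + r = 1 := hsub (by simp [abs_of_nonneg hr])
    refine ⟨0, 0, le_rfl, le_rfl, by simp, ?_, ?_⟩
    · simp [h1, normalCenter, sinhQuot]
    · rw [normalRadius_zero_right]
      rw [h1] at h2
      simpa using h2
  · obtain ⟨q, hq, hqr⟩ := exists_normalRadius_eq hp.le hr (radius_le_of_subset hp hpπ hsub hmem)
    refine ⟨p - q, q, sub_nonneg.2 hq.2, hq.1, by ring, ?_, hqr.symm⟩
    rw [normalCenter_eq, hqr, sub_add_cancel]
    exact center_eq_of_subset hp hpπ hsub hmem

theorem isMaximalDisk_normalDisk_iff {p₁ p₂ : ℝ} (h₁ : 0 ≤ p₁) (h₂ : 0 ≤ p₂) (h0 : 0 < p₁ + p₂)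
    (hπ : p₁ + p₂ < Real.pi) (t : ℝ) :
    IsMaximalDisk (Complex.exp '' Metric.closedBall (0 : ℂ) (p₁ + p₂))
      (Metric.closedBall (normalCenter p₁ p₂ t) (normalRadius p₁ p₂ t)) ↔ p₁ = 0 := by
  constructor
  · intro hmax
    have hR := normalRadius_nonneg h0.le 0 t
    have h := hmax.2 ⟨⟨_, _, hR, rfl⟩, closedBall_normalCenter_subset h0 hπ t⟩
      (normalDisk_subset_maximal h₁ p₂ t)
    change Metric.closedBall _ _ ⊆ Metric.closedBall _ _ at h
    rw [normalCenter_eq, normalCenter_eq, zero_add] at h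
    have hreq := le_of_closedBall_subset_of_tangent (norm_outerNormal _ _)
      (normalRadius_le h₁ p₂ t) hR h
    have : p₂ = p₁ + p₂ := (strictMono_normalRadius (p₁ + p₂) t).injective (by simpa using hreq)
    linarith
  · rintro rfl
    refine ⟨⟨⟨_, _, normalRadius_nonneg h₂ 0 t, rfl⟩, normalDisk_subset h₁ h₂ hπ t⟩, ?_⟩
    rintro _ ⟨⟨z, r, hr, rfl⟩, hsub⟩ hle
    have hmem := hle (boundaryPoint_mem_normalDisk h₂ 0 t)
    have hz := center_eq_of_subset h0 hπ hsub hmem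
    have hrle := radius_le_of_subset h0 hπ hsub hmem
    rw [hz, normalCenter_eq]
    rw [zero_add] at hrle ⊢
    exact closedBall_subset_of_tangent (norm_outerNormal _ _) hrle

/-! ### Normal forms as time-ordered exponentials -/

theorem normalForm_eq_leftExp (p₁ p₂ t : ℝ) {u : ℂ} (hu : ‖u‖ = 1) :
    normalForm p₁ p₂ t (chiralMatrix 0 u) = leftExp (fun θ => p₁ • expI t +
      p₂ • (expI (2 * (p₁ + p₂) * θ * Real.sin t) * chiralMatrix 0 u)) (-1 / 2) (1 / 2) := by
  -- On the symmetric interval `a + b = 0`, so no extra phase remains.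
  have h := leftExp_chiralMatrix p₁ p₂ t (show (-1 / 2 : ℝ) ≤ 1 / 2 by norm_num) hu
  norm_num at h
  rw [normalForm_chiralMatrix, ← h, neg_div]
  congr 1
  funext θ
  simp only [expI_eq_chiralMatrix, chiralMatrix_mul, smul_chiralMatrix, chiralMatrix_add]
  rw [chiralMatrix_inj]
  constructor
  · simp
  · push_cast
    simp only [map_zero, mul_zero, add_zero, zero_add, mul_assoc]
    ring_nf

theorem leftExp_expI {p : ℝ} (hp : 0 ≤ p) (t : ℝ) :
    leftExp (fun _ => expI t) 0 p =
      chiralMatrix (Real.exp (p * Real.cos t) * Complex.exp ((p * Real.sin t : ℝ) * Complex.I))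
        0 := by
  have h := leftExp_chiralMatrix 1 0 t hp (v := 1) (by simp)
  simp only [expI_eq_chiralMatrix]
  convert! h using 1
  · simp
  · rw [chiralMatrix_inj]
    constructor
    · simp [normalCenter, sinhQuot]
    · simp [normalRadius_zero_right]

/-- The offset `q` is a constant phase, absorbed in `v`. The two factorizations choose it so that
the remaining phase cancels the rotation of the other factor. -/
theorem leftExp_expI_mul {p : ℝ} (hp : 0 ≤ p) (q t : ℝ) {u : ℂ} (hu : ‖u‖ = 1) :
    leftExp (fun θ => expI ((2 * θ - q) * Real.sin t) * chiralMatrix 0 u) 0 p =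
      chiralMatrix (normalCenter 0 p t) (normalRadius 0 p t *
        (Complex.exp (((p - q) * Real.sin t : ℝ) * Complex.I) * u)) := by
  have h := leftExp_chiralMatrix 0 1 t hp
    (v := Complex.exp ((-q * Real.sin t : ℝ) * Complex.I) * u)
    (by rw [norm_mul, Complex.norm_exp_ofReal_mul_I, hu, one_mul])
  convert! h using 1
  · congr 1
    funext θ
    rw [expI_eq_chiralMatrix, chiralMatrix_mul, chiralMatrix_inj]
    constructor
    · simp
    · rw [Complex.ofReal_one, one_mul, ← mul_assoc, ← Complex.exp_add]
      simp only [zero_mul, add_zero]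
      congr 2
      push_cast
      ring
  · rw [chiralMatrix_inj]
    constructor
    · simp
    · rw [← mul_assoc (Complex.exp _), ← Complex.exp_add, zero_mul, one_mul, sub_zero]
      congr 3
      push_cast
      ring

theorem normalCenter_eq_mul (p₁ p₂ t : ℝ) : normalCenter p₁ p₂ t =
    Real.exp (p₁ * Real.cos t) * Complex.exp ((p₁ * Real.sin t : ℝ) * Complex.I) *
      normalCenter 0 p₂ t := by
  rw [normalCenter, normalCenter, add_mul p₁ p₂ (Real.sin t), Complex.ofReal_add,
    add_mul ((p₁ * Real.sin t : ℝ) : ℂ), Complex.exp_add, zero_mul, Real.exp_zero, zero_add]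
  push_cast
  ring

theorem normalForm_eq_leftExp_mul_leftExp {p₁ p₂ : ℝ} (h₁ : 0 ≤ p₁) (h₂ : 0 ≤ p₂) (t : ℝ) {u : ℂ}
    (hu : ‖u‖ = 1) : normalForm p₁ p₂ t (chiralMatrix 0 u) = leftExp (fun _ => expI t) 0 p₁ *
      leftExp (fun θ => expI ((2 * θ - p₁ - p₂) * Real.sin t) * chiralMatrix 0 u) 0 p₂ := by
  simp only [sub_sub]
  rw [leftExp_expI h₁, leftExp_expI_mul h₂ _ t hu, chiralMatrix_mul, normalForm_chiralMatrix,
    chiralMatrix_inj, sub_add_cancel_right]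
  constructor
  · simpa using normalCenter_eq_mul p₁ p₂ t
  · simp only [normalRadius, zero_mul, add_zero]
    have : Complex.exp ((p₁ * Real.sin t : ℝ) * Complex.I) *
        Complex.exp ((-p₁ * Real.sin t : ℝ) * Complex.I) = 1 := by
      rw [← Complex.exp_add]
      simp
    rw [Real.exp_zero, one_mul]
    push_cast at this ⊢
    linear_combination (-Complex.exp (p₁ * Complex.cos t) * sinhQuot p₂ (Real.cos t) * u) * this

theorem normalForm_eq_leftExp_mul_leftExp' {p₁ p₂ : ℝ} (h₁ : 0 ≤ p₁) (h₂ : 0 ≤ p₂) (t : ℝ) {u : ℂ}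
    (hu : ‖u‖ = 1) : normalForm p₁ p₂ t (chiralMatrix 0 u) =
      leftExp (fun θ => expI ((2 * θ + p₁ - p₂) * Real.sin t) * chiralMatrix 0 u) 0 p₂ *
        leftExp (fun _ => expI t) 0 p₁ := by
  have hfun (θ : ℝ) : 2 * θ + p₁ - p₂ = 2 * θ - (p₂ - p₁) := by ring
  simp only [hfun]
  rw [leftExp_expI h₁, leftExp_expI_mul h₂ _ t hu, chiralMatrix_mul, normalForm_chiralMatrix,
    chiralMatrix_inj, sub_sub_cancel]
  constructor
  · simpa [mul_comm] using normalCenter_eq_mul p₁ p₂ t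
  · simp only [normalRadius, zero_mul, mul_zero, zero_add, map_mul, Complex.conj_ofReal,
      conj_cexp_mul_I]
    have : Complex.exp ((p₁ * Real.sin t : ℝ) * Complex.I) *
        Complex.exp ((-(p₁ * Real.sin t) : ℝ) * Complex.I) = 1 := by
      rw [← Complex.exp_add]
      simp
    rw [Real.exp_zero, one_mul]
    push_cast at this ⊢
    linear_combination (-Complex.exp (p₁ * Complex.cos t) * sinhQuot p₂ (Real.cos t) * u) * this

/-! ### Assembly of the main theorem -/

theorem exists_int_of_cos_eq_of_sin_eq {t t' : ℝ} (hc : Real.cos t' = Real.cos t)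
    (hs : Real.sin t' = Real.sin t) : ∃ k : ℤ, t' = t + 2 * Real.pi * k := by
  obtain ⟨k, hk⟩ := Real.Angle.angle_eq_iff_two_pi_dvd_sub.1 (Real.Angle.cos_sin_inj hc hs)
  exact ⟨k, by linarith⟩

/-- By compactness the disk already lies in `exp (D(0, q))` for some `q < π`. -/
theorem lt_pi_of_isLeast {A : Matrix (Fin 2) (Fin 2) ℝ} {p : ℝ}
    (hA : chiralDisk A ⊆ Complex.exp '' Metric.ball (0 : ℂ) Real.pi)
    (hp : IsLeast {q : ℝ | chiralDisk A ⊆ Complex.exp '' Metric.closedBall (0 : ℂ) q} p) :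
    p < Real.pi := by
  have hcompact : IsCompact (chiralDisk A) := isCompact_closedBall _ _
  obtain ⟨⟨q, hq⟩, hsub⟩ := hcompact.elim_directed_cover
    (fun q : Set.Iio Real.pi => Complex.exp '' Metric.ball (0 : ℂ) q)
    (fun q => Complex.isOpenMap_exp _ Metric.isOpen_ball)
    (fun z hz => by
      obtain ⟨w, hw, rfl⟩ := hA hz
      rw [mem_ball_zero_iff] at hw
      obtain ⟨q, hwq, hqπ⟩ := exists_between hw
      exact Set.mem_iUnion.2 ⟨⟨q, hqπ⟩, w, by simpa using hwq, rfl⟩)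
    (directed_of_isDirected_le fun q q' h =>
      Set.image_mono (Metric.ball_subset_ball h))
  exact (hp.2 (hsub.trans (Set.image_mono Metric.ball_subset_closedBall))).trans_lt hq

theorem mainTheorem9 (A : Matrix (Fin 2) (Fin 2) ℝ)
    (hA : chiralDisk A ⊆ Complex.exp '' Metric.ball (0 : ℂ) Real.pi)
    (p : ℝ)
    (hp : IsLeast {q : ℝ | chiralDisk A ⊆ Complex.exp '' Metric.closedBall (0 : ℂ) q} p)
    (t : ℝ)
    (ht : Complex.exp ((p : ℂ) * ((Real.cos t : ℂ) + Complex.I * (Real.sin t : ℂ)))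
      ∈ chiralDisk A) :
    -- existence of the normal form, with its realizations as time-ordered exponentials
    (∃ (p₁ p₂ : ℝ) (F : Matrix (Fin 2) (Fin 2) ℝ),
      0 ≤ p₁ ∧ 0 ≤ p₂ ∧ p = p₁ + p₂ ∧ F ∈ conjK ∧
      A = normalForm p₁ p₂ t F ∧
      A = leftExp
        (fun θ => p₁ • expI t + p₂ • (expI (2 * p * θ * Real.sin t) * F)) (-1 / 2) (1 / 2) ∧
      A = leftExp (fun _ => expI t) 0 p₁ *
          leftExp (fun θ => expI ((2 * θ - p₁ - p₂) * Real.sin t) * F) 0 p₂ ∧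
      A = leftExp (fun θ => expI ((2 * θ + p₁ - p₂) * Real.sin t) * F) 0 p₂ *
          leftExp (fun _ => expI t) 0 p₁) ∧
    -- the cases, for an arbitrary normal form of `A` belonging to `p` and `t`
    (∀ (p₁ p₂ : ℝ) (F : Matrix (Fin 2) (Fin 2) ℝ),
      0 ≤ p₁ → 0 ≤ p₂ → p = p₁ + p₂ → F ∈ conjK → A = normalForm p₁ p₂ t F →
      -- the identity matrix
      ((p₁ = 0 ∧ p₂ = 0) ↔ A = 1) ∧
      -- the point disk case
      ((0 < p₁ ∧ p₂ = 0) ↔ (A ≠ 1 ∧ ∃ z : ℂ, chiralDisk A = {z})) ∧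
      (0 < p₁ → p₂ = 0 → ∀ F' ∈ conjK, A = normalForm p₁ p₂ t F') ∧
      -- the maximal disk case
      ((p₁ = 0 ∧ 0 < p₂) ↔
        (A ≠ 1 ∧ IsMaximalDisk (Complex.exp '' Metric.closedBall (0 : ℂ) p) (chiralDisk A))) ∧
      (p₁ = 0 → 0 < p₂ →
        A = normalForm p₁ p₂ (Real.pi - t) F ∧
        ∀ (p₁' p₂' t' : ℝ) (F' : Matrix (Fin 2) (Fin 2) ℝ),
          0 ≤ p₁' → 0 ≤ p₂' → p₁' + p₂' < Real.pi → F' ∈ conjK → A = normalForm p₁' p₂' t' F' →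
          p₁' = p₁ ∧ p₂' = p₂ ∧ F' = F ∧
          ∃ k : ℤ, t' = t + 2 * Real.pi * k ∨ t' = Real.pi - t + 2 * Real.pi * k) ∧
      -- the general case: uniqueness
      (0 < p₁ → 0 < p₂ →
        ∀ (p₁' p₂' t' : ℝ) (F' : Matrix (Fin 2) (Fin 2) ℝ),
          0 ≤ p₁' → 0 ≤ p₂' → p₁' + p₂' < Real.pi → F' ∈ conjK → A = normalForm p₁' p₂' t' F' →
          p₁' = p₁ ∧ p₂' = p₂ ∧ F' = F ∧ ∃ k : ℤ, t' = t + 2 * Real.pi * k)) := by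
  obtain ⟨z, w, rfl⟩ := exists_eq_chiralMatrix A
  have hpπ := lt_pi_of_isLeast hA hp
  have hsub := hp.1
  rw [Set.mem_ofPred_eq] at hsub
  have hnonneg : 0 ≤ p := by
    obtain ⟨v, hv, -⟩ := hsub ht
    exact dist_nonneg.trans hv
  rw [chiralDisk_chiralMatrix] at hsub ht
  refine ⟨?_, ?_⟩
  · obtain ⟨p₁, p₂, h₁, h₂, rfl, hz, hr⟩ := exists_normalParameters hnonneg hpπ hsub ht
    obtain ⟨u, hu, hwu⟩ : ∃ u : ℂ, ‖u‖ = 1 ∧ w = ‖w‖ * u := by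
      by_cases hw : w = 0
      -- For a point disk the phase is arbitrary.
      · exact ⟨1, by simp, by simp [hw]⟩
      · have hw' : (‖w‖ : ℂ) ≠ 0 := by simpa using hw
        exact ⟨w / ‖w‖, by simp [hw], by field_simp⟩
    have hA' : chiralMatrix z w = normalForm p₁ p₂ t (chiralMatrix 0 u) := by
      rw [normalForm_chiralMatrix, ← hz, ← hr, ← hwu]
    exact ⟨p₁, p₂, chiralMatrix 0 u, h₁, h₂, rfl, (mem_conjK_iff _).2 ⟨u, hu, rfl⟩, hA',
      hA'.trans (normalForm_eq_leftExp p₁ p₂ t hu),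
      hA'.trans (normalForm_eq_leftExp_mul_leftExp h₁ h₂ t hu),
      hA'.trans (normalForm_eq_leftExp_mul_leftExp' h₁ h₂ t hu)⟩
  · rintro p₁ p₂ F h₁ h₂ rfl hF hAF
    obtain ⟨u, hu, rfl⟩ := (mem_conjK_iff F).1 hF
    obtain ⟨hz, hw⟩ := chiralMatrix_inj.1 (hAF.trans (normalForm_chiralMatrix p₁ p₂ t u))
    have hnorm : ‖w‖ = normalRadius p₁ p₂ t := by
      rw [hw, norm_mul, hu, mul_one, Complex.norm_real, Real.norm_eq_abs,
        abs_of_nonneg (normalRadius_nonneg h₂ p₁ t)]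
    have hone : p₁ = 0 ∧ p₂ = 0 ↔ chiralMatrix z w = 1 := by
      constructor
      · rintro ⟨rfl, rfl⟩
        rw [chiralMatrix_one, hz, hw, chiralMatrix_inj]
        simp [normalCenter, normalRadius, sinhQuot]
      · intro h1
        -- The disk of the identity is `{1} = exp {0}`, so minimality of `p` forces `p ≤ 0`.
        have hle : p₁ + p₂ ≤ 0 := hp.2 (by
          rw [Set.mem_ofPred_eq, h1, chiralMatrix_one, chiralDisk_chiralMatrix]
          simp)
        constructor <;> linarith
    -- With `p₂ > 0` the radius is nonzero and can be cancelled from `w`, which recovers the phase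
    -- and hence `F`.
    have hunique (p₁' p₂' t' : ℝ) (F' : Matrix (Fin 2) (Fin 2) ℝ) (hpos : 0 < p₂) (h₁' : 0 ≤ p₁')
        (h₂' : 0 ≤ p₂') (hπ' : p₁' + p₂' < Real.pi) (hF' : F' ∈ conjK)
        (hAF' : chiralMatrix z w = normalForm p₁' p₂' t' F') :
        p₁' = p₁ ∧ p₂' = p₂ ∧ F' = chiralMatrix 0 u ∧ Real.sin t' = Real.sin t ∧
          (0 < p₁ → Real.cos t' = Real.cos t) := by
      obtain ⟨u', hu', rfl⟩ := (mem_conjK_iff F').1 hF'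
      obtain ⟨hz', hw'⟩ := chiralMatrix_inj.1 (hAF'.trans (normalForm_chiralMatrix p₁' p₂' t' u'))
      have hnorm' : ‖w‖ = normalRadius p₁' p₂' t' := by
        rw [hw', norm_mul, hu', mul_one, Complex.norm_real, Real.norm_eq_abs,
          abs_of_nonneg (normalRadius_nonneg h₂' p₁' t')]
      obtain ⟨e₁, e₂, hs, hc⟩ := normalParameters_unique h₁ h₂ (by linarith) hpπ h₁' h₂' hπ'
        (hz.symm.trans hz') (hnorm.symm.trans hnorm')
      refine ⟨e₁, e₂, ?_, hs, hc⟩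
      have hR : (normalRadius p₁ p₂ t : ℂ) ≠ 0 := by
        exact_mod_cast (normalRadius_pos hpos p₁ t).ne'
      rw [← hnorm', hnorm, hw] at hw'
      rw [mul_left_cancel₀ hR hw']
    refine ⟨hone, ?_, ?_, ?_, ?_, ?_⟩
    · rw [ne_eq, ← hone, chiralDisk_chiralMatrix, hnorm]
      constructor
      · rintro ⟨hpos, rfl⟩
        exact ⟨fun h => hpos.ne' h.1, z, by rw [normalRadius_zero_right, Metric.closedBall_zero]⟩
      · rintro ⟨hne, z', hz'⟩
        have h20 : p₂ = 0 := by
          by_contra h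
          have hR := normalRadius_pos (h₂.lt_of_ne' h) p₁ t
          have hm1 : z ∈ ({z'} : Set ℂ) := hz' ▸ Metric.mem_closedBall_self hR.le
          have hm2 : z + normalRadius p₁ p₂ t ∈ ({z'} : Set ℂ) := hz' ▸ by
            simp [abs_of_pos hR]
          rw [Set.mem_singleton_iff] at hm1 hm2
          rw [hm1, add_eq_left, Complex.ofReal_eq_zero] at hm2
          exact hR.ne' hm2
        exact ⟨h₁.lt_of_ne' fun h => hne ⟨h, h20⟩, h20⟩
    · rintro - rfl F' hF'
      obtain ⟨u', -, rfl⟩ := (mem_conjK_iff F').1 hF'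
      rw [hAF, normalForm_chiralMatrix, normalForm_chiralMatrix, normalRadius_zero_right]
      simp
    · rw [ne_eq, ← hone, chiralDisk_chiralMatrix, hnorm, hz]
      constructor
      · rintro ⟨h10, hpos⟩
        exact ⟨fun h => hpos.ne' h.2,
          (isMaximalDisk_normalDisk_iff h₁ h₂ (by linarith) hpπ t).2 h10⟩
      · rintro ⟨hne, hmax⟩
        have h0 : 0 < p₁ + p₂ := (add_nonneg h₁ h₂).lt_of_ne' fun h =>
          hne ⟨by linarith, by linarith⟩
        have h10 := (isMaximalDisk_normalDisk_iff h₁ h₂ h0 hpπ t).1 hmax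
        exact ⟨h10, by linarith⟩
    · rintro rfl hpos
      refine ⟨?_, fun p₁' p₂' t' F' h₁' h₂' hπ' hF' hAF' => ?_⟩
      · rw [hAF, normalForm, normalForm, Real.cos_pi_sub, Real.sin_pi_sub, sinhQuot_neg, mul_neg,
          mul_neg, Real.cosh_neg, zero_mul, neg_zero]
      · obtain ⟨e₁, e₂, e₃, hs, -⟩ := hunique p₁' p₂' t' F' hpos h₁' h₂' hπ' hF' hAF'
        refine ⟨e₁, e₂, e₃, ?_⟩
        have hcos : |Real.cos t'| = |Real.cos t| := by
          rw [Real.abs_cos_eq_sqrt_one_sub_sin_sq, Real.abs_cos_eq_sqrt_one_sub_sin_sq, hs]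
        rcases abs_eq_abs.1 hcos with hc | hc
        · obtain ⟨k, hk⟩ := exists_int_of_cos_eq_of_sin_eq hc hs
          exact ⟨k, Or.inl hk⟩
        · obtain ⟨k, hk⟩ := exists_int_of_cos_eq_of_sin_eq (t := Real.pi - t)
            (by rw [hc, Real.cos_pi_sub]) (by rw [hs, Real.sin_pi_sub])
          exact ⟨k, Or.inr hk⟩
    · intro hpos₁ hpos p₁' p₂' t' F' h₁' h₂' hπ' hF' hAF'
      obtain ⟨e₁, e₂, e₃, hs, hc⟩ := hunique p₁' p₂' t' F' hpos h₁' h₂' hπ' hF' hAF'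
      exact ⟨e₁, e₂, e₃, exists_int_of_cos_eq_of_sin_eq (hc hpos₁) hs⟩
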